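/- A neutral Kähler 4-manifold $(M,\mathbb G,\mathbb J)$ is oriented so that its Kähler form is self-dual. A $\beta$-surface in $M$ is a smooth immersion $f:\Sigma\to M$ of a connected smooth surface $\Sigma$ such that every anti-self-dual 2-form ($*\omega=-\omega$) vanishes on every tangent plane $df(T_p\Sigma)$. Say that $\Sigma$ is a *piece* of a set $B\subset M$ if $f(\Sigma)$ is a relatively open subset of $B$. Let $N$ be the round sphere $S^2$ or the hyperbolic plane $H^2$. In a conformal coordinate $\xi$ with $g=e^{2u}|d\xi|^2$ and the fibre coordinate $\eta\leftrightarrow\eta\partial_\xi+\bar\eta\partial_{\bar\xi}$, the tangent bundle $TN$ carries the complex structure in which $\xi,\eta$ are holomorphic and the neutral Kähler metric $$\mathbb G=2e^{2u}\,\mathrm{Im}\left(d\bar\eta\,d\xi-2\eta\,\partial_\xi u\,d\xi\,d\bar\xi\right).$$ With it, $TS^2=\mathbb L(\mathbb E^3)$ is the space of oriented lines of $\mathbb E^3$ and $TH^2=\mathbb L(\mathbb E^3_1)$ is the space of future-pointing time-like lines of $\mathbb E^3_1$. An affine tangent bundle over a curve $c$ in $N$ is a subset of $TN$ lying over $c$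 whose fibre over each point of $c$ is an affine line of the tangent plane of $N$ parallel to $c'$, depending smoothly on the point. Let $\mathbb L(\mathbb H^3)=\mathbb P^1\times\mathbb P^1-\bar\Delta$, $\bar\Delta=\{\mu_1\bar\mu_2=-1\}$, be the space of oriented geodesics of $\mathbb H^3$ (the ideal end points of the geodesic $(\mu_1,\mu_2)$ are $\mu_1$ and $-1/\bar\mu_2$), with the product complex structure and the neutral Kähler metric $$\mathbb G=-i\left[\frac{d\mu_1\,d\bar\mu_2}{(1+\mu_1\bar\mu_2)^2}-\frac{d\bar\mu_1\,d\mu_2}{(1+\bar\mu_1\mu_2)^2}\right],$$ and identify $\mathbb P^1$ with $S^2\subset\mathbb R^3$ by stereographic projection, $\mu=(x_1+ix_2)/(1+x_3)$. **Theorem.** (a) Every $\beta$-surface in $\mathbb L(\mathbb E^3)=TS^2$ is a piece of an affine tangent bundle over a smooth curve of constant geodesic curvature in $S^2$. (b) Every $\beta$-surface in $\mathbb L(\mathbb E^3_1)=TH^2$ is a piece of an affine tangent bundle over a smooth curve of constant geodesic curvature in $H^2$. (c) Every $\beta$-surface in $\mathbb L(\mathbb H^3)$ is a piece of a torus $K_1\times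 K_2$, where $K_1,K_2\subset S^2$ are circles, and some isometry of $(\mathbb L(\mathbb H^3),\mathbb G)$ maps $(K_1\times K_2)-\bar\Delta$ onto one of the following: 1. $\mathbb L(\mathbb H^2)$, the set of oriented geodesics contained in a totally geodesic $\mathbb H^2\subset\mathbb H^3$; 2. $(\mathcal C_1\times\mathcal C_2)-\bar\Delta$, where $\mathcal C_1$ is a circle given by the intersection of $S^2$ with a plane containing the north pole $(0,0,1)$ and $\mathcal C_2$ is the image of $\mathcal C_1$ under reflection in the horizontal plane through the origin. -/

import Mathlib

open Set
open scoped Manifold ContDiff Matrix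

noncomputable section

namespace BetaSurf

/-! ### Linear algebra of a neutral Hermitian 4-space -/

/-- The signature `(+,+,-,-)` of `ds² = (dx¹)² + (dx²)² - (dx³)² - (dx⁴)²`. -/
def sig : Fin 4 → ℝ := ![1, 1, -1, -1]

/-- The Levi-Civita symbol. -/
def leviCivita (i j k l : Fin 4) : ℤ :=
  Matrix.det (Matrix.of fun a b : Fin 4 => if ![i, j, k, l] a = b then (1 : ℤ) else 0)

/-- Explicit value of the Levi-Civita symbol. -/
theorem leviCivita_eq (i j k l : Fin 4) : leviCivita i j k l =
    if i = j ∨ i = k ∨ i = l ∨ j = k ∨ j = l ∨ k = l then 0 else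
      (if i < j then 1 else -1) * (if i < k then 1 else -1) * (if i < l then 1 else -1) *
      (if j < k then 1 else -1) * (if j < l then 1 else -1) * (if k < l then 1 else -1) := by
  revert i j k l
  simp only [leviCivita, Matrix.det_succ_row_zero, Fin.sum_univ_succ]
  decide +kernel

/-- The volume form of `ℝ^{2,2}` on the standard basis vectors, `vol (e_i, e_j, e_k, e_l)`.
The orientation is the one for which the Kähler form `dx¹ ∧ dx² - dx³ ∧ dx⁴` is self-dual,
i.e. `vol = - dx¹ ∧ dx² ∧ dx³ ∧ dx⁴`. -/
def vol (i j k l : Fin 4) : ℝ := -(leviCivita i j k l : ℝ)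

/-- A 4-manifold `carrier` sitting in a vector space `W`, with its tangent spaces, a neutral
metric and a complex structure on the tangent spaces.  (Only the two concrete examples
`tangentBundleData` and `geodesicsH3` below are used.) -/
structure NeutralData (W : Type*) [AddCommGroup W] [Module ℝ W] where
  carrier : Set W
  tangent : W → Submodule ℝ W
  metric : W → W → W → ℝ
  cplx : W → W → W

section Linear

variable {W : Type*} [AddCommGroup W] [Module ℝ W]

/-- A unitary frame of the tangent space at `p`: it identifies the tangent space with `ℝ^{2,2}`
endowed with its metric and `J (X¹, X², X³, X⁴) = (-X², X¹, -X⁴, X³)`. -/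
def IsUnitaryFrame (M : NeutralData W) (p : W) (e : Fin 4 → W) : Prop :=
  (∀ i, e i ∈ M.tangent p) ∧
  (∀ i j, M.metric p (e i) (e j) = if i = j then sig i else 0) ∧
  M.cplx p (e 0) = e 1 ∧ M.cplx p (e 2) = e 3

/-- The components `(*σ)(e_i, e_j)` of the Hodge star of a 2-form in a unitary frame:
`(*σ)_{ij} = ½ σ^{kl} vol_{klij}`. -/
def hodgeStar (e : Fin 4 → W) (σ : LinearMap.BilinForm ℝ W) (i j : Fin 4) : ℝ :=
  (1 / 2) * ∑ k, ∑ l, sig k * sig l * σ (e k) (e l) * vol k l i j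

/-- The 2-form `σ` restricts to an anti-self-dual 2-form on the tangent space at `p`:
`*σ = -σ`.  (Every 2-form on the tangent space is the restriction of one on `W`.) -/
def IsAntiSelfDual (M : NeutralData W) (p : W) (σ : LinearMap.BilinForm ℝ W) : Prop :=
  σ.IsAlt ∧ ∃ e, IsUnitaryFrame M p e ∧ ∀ i j, hodgeStar e σ i j = -σ (e i) (e j)

/-- The anti-self-duality equations written out. -/
theorem antiSelfDual_iff {W : Type*} [AddCommGroup W] [Module ℝ W] (e : Fin 4 → W)
    (σ : LinearMap.BilinForm ℝ W) (hσ : σ.IsAlt) :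
    (∀ i j, hodgeStar e σ i j = -σ (e i) (e j)) ↔
      σ (e 0) (e 1) = σ (e 2) (e 3) ∧ σ (e 0) (e 2) = σ (e 1) (e 3) ∧
        σ (e 0) (e 3) = -σ (e 1) (e 2) := by
  have h10 := hσ.neg_eq (e 0) (e 1)
  have h20 := hσ.neg_eq (e 0) (e 2)
  have h30 := hσ.neg_eq (e 0) (e 3)
  have h21 := hσ.neg_eq (e 1) (e 2)
  have h31 := hσ.neg_eq (e 1) (e 3)
  have h32 := hσ.neg_eq (e 2) (e 3)
  have h0 := hσ (e 0)
  have h1 := hσ (e 1)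
  have h2 := hσ (e 2)
  have h3 := hσ (e 3)
  simp only [Fin.forall_fin_succ, IsEmpty.forall_iff, and_true]
  simp [hodgeStar, vol, sig, leviCivita_eq, Fin.sum_univ_four, 
     ← h10, ← h20, ← h30, ← h21, ← h31, ← h32, h0, h1, h2, h3]
  constructor
  · rintro ⟨⟨a1, a2, a3⟩, -⟩
    refine ⟨?_, ?_, ?_⟩ <;> linarith
  · rintro ⟨a1, a2, a3⟩
    refine ⟨⟨?_, ?_, ?_⟩, ⟨?_, ?_, ?_⟩, ⟨?_, ?_, ?_⟩, ?_, ?_, ?_⟩ <;> linarith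

end Linear

/-- `f` is an immersed β-surface of `M`: a smooth immersion of a surface `S` into `M` such that
every anti-self-dual 2-form vanishes on every tangent plane. -/
def IsBetaSurface {W : Type*} [NormedAddCommGroup W] [NormedSpace ℝ W] (M : NeutralData W)
    {S : Type*} [TopologicalSpace S] [ChartedSpace (EuclideanSpace ℝ (Fin 2)) S]
    (f : S → W) : Prop :=
  (∀ p, f p ∈ M.carrier) ∧
  ContMDiff (𝓡 2) 𝓘(ℝ, W) ∞ f ∧
  (∀ p, Function.Injective (mfderiv (𝓡 2) 𝓘(ℝ, W) f p)) ∧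
  ∀ p, ∀ σ : LinearMap.BilinForm ℝ W, IsAntiSelfDual M (f p) σ →
    ∀ X Y : TangentSpace (𝓡 2) p,
      σ (mfderiv (𝓡 2) 𝓘(ℝ, W) f p X) (mfderiv (𝓡 2) 𝓘(ℝ, W) f p Y) = 0

/-- `A` is a piece (a relatively open subset) of `B`. -/
def IsPieceOf {W : Type*} [TopologicalSpace W] (A B : Set W) : Prop :=
  ∃ U : Set W, IsOpen U ∧ A = B ∩ U

/-- `Φ` restricts to an isometry of `M`: a diffeomorphism of `M` preserving the metric. -/
def IsIsometry {W : Type*} [NormedAddCommGroup W] [NormedSpace ℝ W] (M : NeutralData W)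
    (Φ : W → W) : Prop :=
  BijOn Φ M.carrier M.carrier ∧
  (∃ U, IsOpen U ∧ M.carrier ⊆ U ∧ ContDiffOn ℝ ∞ Φ U) ∧
  (∃ Ψ : W → W, (∀ p ∈ M.carrier, Ψ (Φ p) = p) ∧
    ∃ U, IsOpen U ∧ M.carrier ⊆ U ∧ ContDiffOn ℝ ∞ Ψ U) ∧
  ∀ p ∈ M.carrier, ∀ X ∈ M.tangent p, ∀ Y ∈ M.tangent p,
    M.metric (Φ p) (fderiv ℝ Φ p X) (fderiv ℝ Φ p Y) = M.metric p X Y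

/-- Three-dimensional space. -/
abbrev V3 : Type := Fin 3 → ℝ

/-- The determinant `det (a, b, c)`. -/
def det3 (a b c : V3) : ℝ := a ⬝ᵥ (b ⨯₃ c)

/-! ### The tangent bundles of `S²` and `H²`

Both cases are treated at once: `ε = 1` gives Euclidean space `𝔼³` and the unit sphere `S²`,
`ε = -1` gives Lorentzian space `𝔼³₁` and the (future) hyperboloid model of `H²`. -/

/-- The inner product of `𝔼³` (`ε = 1`) or of `𝔼³₁` (`ε = -1`). -/
def ip (ε : ℝ) (x y : V3) : ℝ := x 0 * y 0 + x 1 * y 1 + ε * (x 2 * y 2)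

/-- The round sphere `S²` (`ε = 1`) or the hyperbolic plane `H²` (`ε = -1`), with the
Riemannian metric induced by `ip ε`. -/
def baseSurface (ε : ℝ) : Set V3 := {x | ip ε x x = ε ∧ (ε < 0 → 0 < x 2)}

/-- Rotation by `+90°` in the tangent plane at `x`: the complex structure of `S²` or `H²`,
characterised by `ip ε (rot ε x a) b = det (x, a, b)`, the area form at `x`. -/
def rot (ε : ℝ) (x a : V3) : V3 := ![(x ⨯₃ a) 0, (x ⨯₃ a) 1, ε * (x ⨯₃ a) 2]

/-- Characterisation of `rot`. -/
theorem ip_rot (ε : ℝ) (hε : ε * ε = 1) (x a b : V3) :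
    ip ε (rot ε x a) b = det3 x a b := by
  simp only [ip, rot, det3, cross_apply, dotProduct, Fin.sum_univ_three, Matrix.cons_val_zero,
    Matrix.cons_val_one, Matrix.cons_val]
  linear_combination ((x 0 * a 1 - x 1 * a 0) * b 2) * hε

/-- The tangent space of `TN` at `(x, v)`, for `TN = {(x, v) | x ∈ N, ⟨x, v⟩ = 0}`. -/
def tangentTN (ε : ℝ) (p : V3 × V3) : Submodule ℝ (V3 × V3) where
  carrier := {X | ip ε p.1 X.1 = 0 ∧ ip ε X.1 p.2 + ip ε p.1 X.2 = 0}
  add_mem' := by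
    rintro X Y ⟨h1, h2⟩ ⟨h3, h4⟩
    simp only [mem_ofPred_eq, ip, Prod.fst_add, Prod.snd_add, Pi.add_apply] at *
    exact ⟨by linear_combination h1 + h3, by linear_combination h2 + h4⟩
  zero_mem' := by simp [ip]
  smul_mem' := by
    rintro c X ⟨h1, h2⟩
    simp only [mem_ofPred_eq, ip, Prod.smul_fst, Prod.smul_snd, Pi.smul_apply, smul_eq_mul] at *
    exact ⟨by linear_combination c * h1, by linear_combination c * h2⟩

/-- The vertical part `∇v` of a tangent vector `(ẋ, v̇)` of `TN` with respect to the Levi-Civita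
connection: the component of `v̇` tangent to `N` at `x`. -/
def vert (ε : ℝ) (x b : V3) : V3 := b - (ε * ip ε x b) • x

/-- The neutral Kähler 4-manifold `TN`, `N = S²` (`ε = 1`) or `N = H²` (`ε = -1`).

A point `(x, v)` is the oriented line of `𝔼³` (the future-pointing time-like line of `𝔼³₁`) with
direction `x`, passing through the point `v` orthogonal to `x`.

In a conformal coordinate `ξ` of `N` (metric `e^{2u} |dξ|²`) and the fibre coordinate `η`, the
vertical part of a tangent vector is `θ = dη + 2 η ∂_ξ u dξ`; the metric is
`𝔾 = 2 e^{2u} Im (dη̄ dξ - 2 η ∂_ξ u dξ dξ̄) = 2 e^{2u} Im (θ̄ dξ)`, that is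
`𝔾 (X, X) = 2 dA (∇v, ẋ)` with the area form `dA` of `N`; and the complex structure
`(dξ, dη) ↦ (i dξ, i dη)`, equivalently `(dξ, θ) ↦ (i dξ, i θ)`, rotates both the horizontal part
`ẋ` and the vertical part `∇v` by `90°`. -/
def tangentBundleData (ε : ℝ) : NeutralData (V3 × V3) where
  carrier := {p | p.1 ∈ baseSurface ε ∧ ip ε p.1 p.2 = 0}
  tangent := tangentTN ε
  metric p X Y := det3 p.1 (vert ε p.1 X.2) Y.1 + det3 p.1 (vert ε p.1 Y.2) X.1
  cplx p X :=
    (rot ε p.1 X.1,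
      rot ε p.1 (vert ε p.1 X.2) - (ε * ip ε (rot ε p.1 X.1) p.2) • p.1)

/-- `c` is a smooth curve in `N`, parametrised by arc length, whose geodesic curvature
`g (∇_T T, j T)`, `T = c'`, is constant.  (The inner product with the tangent vector `j T` only
sees the tangential part `∇_T T` of `c''`.) -/
def HasConstGeodesicCurvature (ε : ℝ) (c : ℝ → V3) : Prop :=
  ContDiff ℝ ∞ c ∧ (∀ s, c s ∈ baseSurface ε) ∧ (∀ s, ip ε (deriv c s) (deriv c s) = 1) ∧
  ∃ k : ℝ, ∀ s, ip ε (deriv (deriv c) s) (rot ε (c s) (deriv c s)) = k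

/-- `B ⊆ TN` is an affine tangent bundle over the curve `c`: the fibre of `B` over each point of
`c` is an affine line in the tangent plane of `N` parallel to the tangent line of `c`, depending
smoothly on the point (it passes through `w s`, for a smooth vector field `w` along `c`). -/
def IsAffineTangentBundle (ε : ℝ) (c : ℝ → V3) (B : Set (V3 × V3)) : Prop :=
  ∃ w : ℝ → V3, ContDiff ℝ ∞ w ∧ (∀ s, ip ε (c s) (w s) = 0) ∧
    (∀ s s', c s = c s' → ∃ t : ℝ, w s' = w s + t • deriv c s) ∧
    B = {p | ∃ s t : ℝ, p = (c s, w s + t • deriv c s)}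

/-! ### Oriented geodesics of `H³` -/

/-- The unit sphere `S² = ℙ¹`, with the complex coordinate `μ = (x₁ + i x₂) / (1 + x₃)`. -/
def sphere2 : Set V3 := {x | x ⬝ᵥ x = 1}

/-- The tangent space of `S² × S²`. -/
def tangentS2S2 (p : V3 × V3) : Submodule ℝ (V3 × V3) where
  carrier := {X | p.1 ⬝ᵥ X.1 = 0 ∧ p.2 ⬝ᵥ X.2 = 0}
  add_mem' := by
    rintro X Y ⟨h1, h2⟩ ⟨h3, h4⟩
    simp_all [dotProduct_add]
  zero_mem' := by simp
  smul_mem' := by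
    rintro c X ⟨h1, h2⟩
    simp_all [dotProduct_smul]

/-- `2 Im (dμ₁(a) conj(dμ₂(b)) / (1 + μ₁ μ̄₂)²)`, for `a` tangent to `S²` at `x` and `b` tangent to
`S²` at `y`, written without coordinates; see `mixed_stereo`. -/
def mixed (x y a b : V3) : ℝ :=
  -det3 y a b / (1 + x ⬝ᵥ y) + (a ⬝ᵥ y) * det3 y x b / (1 + x ⬝ᵥ y) ^ 2

/-- The point of `S²` with complex coordinate `p + i q`. -/
def stereo (p q : ℝ) : V3 :=
  (1 + p ^ 2 + q ^ 2)⁻¹ • ![2 * p, 2 * q, 1 - p ^ 2 - q ^ 2]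

/-- The tangent vector of `S²` at the point with coordinate `μ = p + i q` with `dμ = a + i b`. -/
def dstereo (p q a b : ℝ) : V3 :=
  (1 + p ^ 2 + q ^ 2)⁻¹ • ![2 * a, 2 * b, -2 * (p * a + q * b)] -
    (2 * (p * a + q * b) * (1 + p ^ 2 + q ^ 2)⁻¹) • stereo p q

/-- `dstereo` is the differential of `stereo`. -/
theorem hasDerivAt_stereo {p q : ℝ → ℝ} {a b t : ℝ} (hp : HasDerivAt p a t)
    (hq : HasDerivAt q b t) :
    HasDerivAt (fun s => stereo (p s) (q s)) (dstereo (p t) (q t) a b) t := by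
  have h0 : (1 + p t ^ 2 + q t ^ 2) ≠ 0 := by positivity
  have hr : HasDerivAt (fun s => (1 + p s ^ 2 + q s ^ 2)⁻¹)
      (-(2 * (p t * a + q t * b)) / (1 + p t ^ 2 + q t ^ 2) ^ 2) t := by
    have h1 : HasDerivAt (fun s => 1 + p s ^ 2 + q s ^ 2) (2 * (p t * a + q t * b)) t := by
      refine (((hp.pow 2).const_add 1).add (hq.pow 2)).congr_deriv ?_
      norm_num; ring
    exact h1.inv h0
  rw [hasDerivAt_pi]
  intro i
  fin_cases i
  · have h := hr.mul (hp.const_mul 2)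
    have hf : (fun s => stereo (p s) (q s) 0) =
        (fun s => (1 + p s ^ 2 + q s ^ 2)⁻¹) * fun s => 2 * p s := by
      funext s; simp [stereo]
    change HasDerivAt (fun s => stereo (p s) (q s) 0) (dstereo (p t) (q t) a b 0) t
    rw [hf]
    refine h.congr_deriv ?_
    simp [stereo, dstereo]; field_simp; ring
  · have h := hr.mul (hq.const_mul 2)
    have hf : (fun s => stereo (p s) (q s) 1) =
        (fun s => (1 + p s ^ 2 + q s ^ 2)⁻¹) * fun s => 2 * q s := by
      funext s; simp [stereo]
    change HasDerivAt (fun s => stereo (p s) (q s) 1) (dstereo (p t) (q t) a b 1) t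
    rw [hf]
    refine h.congr_deriv ?_
    simp [stereo, dstereo]; field_simp; ring
  · have h := hr.mul (((hp.pow 2).const_sub 1).sub (hq.pow 2))
    have hf : (fun s => stereo (p s) (q s) 2) =
        (fun s => (1 + p s ^ 2 + q s ^ 2)⁻¹) * ((fun x => 1 - (p ^ 2) x) - q ^ 2) := by
      funext s; simp [stereo]
    change HasDerivAt (fun s => stereo (p s) (q s) 2) (dstereo (p t) (q t) a b 2) t
    rw [hf]
    refine h.congr_deriv ?_
    simp [stereo, dstereo]; field_simp; ring

/-- Coordinate expression of `mixed`. -/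
theorem mixed_stereo (p q a b p' q' a' b' : ℝ)
    (h : (1 : ℂ) + (p + q * Complex.I) * (p' - q' * Complex.I) ≠ 0) :
    mixed (stereo p q) (stereo p' q') (dstereo p q a b) (dstereo p' q' a' b') =
      2 * ((a + b * Complex.I) * (a' - b' * Complex.I) /
        (1 + (p + q * Complex.I) * (p' - q' * Complex.I)) ^ 2 : ℂ).im := by
  set u : ℝ := 1 + p * p' + q * q' with hu
  set w : ℝ := q * p' - p * q' with hw
  have hc : (1 : ℂ) + (p + q * Complex.I) * (p' - q' * Complex.I) = u + w * Complex.I := by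
    rw [hu, hw]; push_cast; linear_combination (-(q:ℂ) * q') * Complex.I_sq
  have hne : u ^ 2 + w ^ 2 ≠ 0 := by
    intro h0
    apply h
    rw [hc]
    have h1 : u = 0 := by nlinarith [sq_nonneg u, sq_nonneg w]
    have h2 : w = 0 := by nlinarith [sq_nonneg u, sq_nonneg w]
    simp [h1, h2]
  have hne' : (u : ℂ) + w * Complex.I ≠ 0 := hc ▸ h
  have hd : (0:ℝ) < 1 + p ^ 2 + q ^ 2 := by positivity
  have hd' : (0:ℝ) < 1 + p' ^ 2 + q' ^ 2 := by positivity
  have hre : (((u : ℂ) + w * Complex.I) ^ 2).re = u ^ 2 - w ^ 2 := by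
    simp [pow_two]
  have him : (((u : ℂ) + w * Complex.I) ^ 2).im = 2 * (u * w) := by
    simp [pow_two]; ring
  have hns : Complex.normSq (((u : ℂ) + w * Complex.I) ^ 2) = (u ^ 2 + w ^ 2) ^ 2 := by
    rw [Complex.normSq_apply, hre, him]; ring
  have hzr : (((a : ℂ) + b * Complex.I) * (a' - b' * Complex.I)).re = a * a' + b * b' := by
    simp
  have hzi : (((a : ℂ) + b * Complex.I) * (a' - b' * Complex.I)).im = b * a' - a * b' := by
    simp; ring
  rw [hc, Complex.div_im, hre, him, hns, hzr, hzi]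
  have hdot : 1 + stereo p q ⬝ᵥ stereo p' q' =
      2 * (u ^ 2 + w ^ 2) / ((1 + p ^ 2 + q ^ 2) * (1 + p' ^ 2 + q' ^ 2)) := by
    simp only [stereo, dotProduct, Fin.sum_univ_three, Pi.smul_apply, smul_eq_mul,
      Matrix.cons_val_zero, Matrix.cons_val_one, Matrix.cons_val]
    rw [hu, hw]
    field_simp
    ring
  simp only [mixed]
  rw [hdot]
  simp only [det3, stereo, dstereo, cross_apply, dotProduct, Fin.sum_univ_three, Pi.smul_apply, smul_eq_mul, Pi.sub_apply,
      Matrix.cons_val_zero, Matrix.cons_val_one, Matrix.cons_val]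
  field_simp
  rw [hu, hw]
  ring

/-- The neutral Kähler 4-manifold `𝕃(H³) = ℙ¹ × ℙ¹ - Δ̄` of oriented geodesics of `H³`, with
`ℙ¹ = S²` and `Δ̄ = {μ₁ μ̄₂ = -1}` the set of pairs of antipodal points, the complex structure
`j ⊕ j`, and the metric
`𝔾 = -i [dμ₁ dμ̄₂ / (1 + μ₁ μ̄₂)² - dμ̄₁ dμ₂ / (1 + μ̄₁ μ₂)²] = 2 Im (dμ₁ dμ̄₂ / (1 + μ₁ μ̄₂)²)`. -/
def geodesicsH3 : NeutralData (V3 × V3) where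
  carrier := {p | p.1 ∈ sphere2 ∧ p.2 ∈ sphere2 ∧ p.1 ≠ -p.2}
  tangent := tangentS2S2
  metric p X Y := (mixed p.1 p.2 X.1 Y.2 + mixed p.1 p.2 Y.1 X.2) / 2
  cplx p X := (p.1 ⨯₃ X.1, p.2 ⨯₃ X.2)

/-- Lorentzian inner product on `ℝ³ × ℝ = ℝ^{3,1}`. -/
def lorentz (P Q : V3 × ℝ) : ℝ := P.1 ⬝ᵥ Q.1 - P.2 * Q.2

/-- Hyperbolic 3-space (hyperboloid model). -/
def H3 : Set (V3 × ℝ) := {P | lorentz P P = -1 ∧ 0 < P.2}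

/-- The geodesic of `H³` represented by `p = (μ₁, μ₂) ∈ 𝕃(H³)`: its ideal end points are `μ₁` and
the antipodal point `-1 / μ̄₂` of `μ₂`, i.e. the null rays through `(x, 1)` and `(-y, 1)`. -/
def geodesic (p : V3 × V3) : Set (V3 × ℝ) :=
  {P | P ∈ H3 ∧ ∃ s t : ℝ, P = s • ((p.1, 1) : V3 × ℝ) + t • ((-p.2, 1) : V3 × ℝ)}

/-- The totally geodesic `H² ⊂ H³` orthogonal to `n` (where `n` is space-like). -/
def H2in (n : V3 × ℝ) : Set (V3 × ℝ) := {P | P ∈ H3 ∧ lorentz n P = 0}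

/-- `𝕃(H²) ⊂ 𝕃(H³)`: the oriented geodesics contained in the totally geodesic `H²`. -/
def geodesicsH2 (n : V3 × ℝ) : Set (V3 × V3) :=
  {p | p ∈ geodesicsH3.carrier ∧ geodesic p ⊆ H2in n}

/-- `C` is a circle of `S²`: a non-degenerate intersection with a plane `m ⬝ᵥ x = d`. -/
def IsCircle (C : Set V3) : Prop :=
  ∃ (m : V3) (d : ℝ), d ^ 2 < m ⬝ᵥ m ∧ C = {x | x ∈ sphere2 ∧ m ⬝ᵥ x = d}

/-- The north pole. -/
def northPole : V3 := ![0, 0, 1]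

/-- Reflection in the horizontal plane through the origin. -/
def reflectHor (x : V3) : V3 := ![x 0, x 1, -x 2]

end BetaSurf

end

noncomputable section

namespace BetaSurf

/-! ### Tangent planes of β-surfaces in charts -/

/-! The argument is the same in all three cases. At each point, three explicit anti-self-dual
2-forms suffice. On `TN` they are the area form on horizontal parts, the area form on vertical
parts, and a mixed term. On `𝕃(H³)` they are the area forms of the two factors and a mixed term.
Where the two area terms vanish, both components of the differential have rank at most one; by
injectivity each kernel is then a line on which the other component is injective. The mixed term
then forces the two image directions to be aligned (`rank_one_pair`): on `TN` they are the same
direction `a`, and on `𝕃(H³)` they lie with `x + y` in one plane of `ℝ³`.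

Such a tangent plane has a conormal `n`, unique up to scale, annihilating the differentials of two
vector-valued functions `F₁`, `F₂`. On `TN` these are the base point `x` and the vector `v`. On
`𝕃(H³)` they are the null vectors `(x, 1)` and `(-y, 1)` of `ℝ^{3,1}` representing the ideal end
points. Differentiating `⟨n, dFᵢ⟩ = 0` and using the symmetry of second derivatives shows that the
suitably normalised `n` is locally constant (`fderiv_conormal_eq_zero`).

On `TN` a constant conormal `m` means that `x` runs in the geodesic `⟨x, m⟩ = 0` and that `⟨v, m⟩`
is constant. The curve obtained therefore always has geodesic curvature zero. On `𝕃(H³)` a constant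
conormal `(m, d)` means that both end points stay on the ideal circle of one totally geodesic plane.
The torus minus `Δ̄` is then already some `𝕃(H²)`, and the isometry can be the identity.

Two topological steps finish the proof. Connectedness glues the local conormals, which are unique
only up to scale (`exists_global_parameter`), and the inverse function theorem makes the image
relatively open (`isPieceOf_range`). The proof is carried by `exists_local_conormal_TN` and
`exists_local_conormal_H3`. -/

/-- The plane of model coordinates of surfaces. -/
abbrev Plane : Type := EuclideanSpace ℝ (Fin 2)

section Chart

variable {W : Type*} [NormedAddCommGroup W] [NormedSpace ℝ W]

/-- The linear map `L` parametrises a tangent plane at `w` on which all anti-self-dual 2-forms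
vanish. -/
def IsBetaPlane (M : NeutralData W) (w : W) (L : Plane →L[ℝ] W) : Prop :=
  Function.Injective L ∧ ∀ σ : LinearMap.BilinForm ℝ W, IsAntiSelfDual M w σ →
    ∀ X Y, σ (L X) (L Y) = 0

variable {S : Type*} [TopologicalSpace S] [ChartedSpace Plane S] [IsManifold (𝓡 2) ∞ S]

theorem contDiffOn_comp_chart_symm {f : S → W} (hf : ContMDiff (𝓡 2) 𝓘(ℝ, W) ∞ f) (p₀ : S) :
    ContDiffOn ℝ ∞ (f ∘ (extChartAt (𝓡 2) p₀).symm) (extChartAt (𝓡 2) p₀).target := by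
  rw [← contMDiffOn_iff_contDiffOn]
  exact hf.comp_contMDiffOn (contMDiffOn_extChartAt_symm p₀)

theorem mfderiv_eq_fderiv_comp_chart {f : S → W} (hf : ContMDiff (𝓡 2) 𝓘(ℝ, W) ∞ f) {p₀ p : S}
    (hp : p ∈ (extChartAt (𝓡 2) p₀).source) (X : TangentSpace (𝓡 2) p) :
    mfderiv (𝓡 2) 𝓘(ℝ, W) f p X =
      fderiv ℝ (f ∘ (extChartAt (𝓡 2) p₀).symm) (extChartAt (𝓡 2) p₀ p)
        (mfderiv (𝓡 2) 𝓘(ℝ, Plane) (extChartAt (𝓡 2) p₀) p X) := by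
  have hopen : IsOpen (extChartAt (𝓡 2) p₀).target := isOpen_extChartAt_target p₀
  have hd : DifferentiableAt ℝ (f ∘ (extChartAt (𝓡 2) p₀).symm) (extChartAt (𝓡 2) p₀ p) :=
    ((contDiffOn_comp_chart_symm hf p₀).contDiffAt
      (hopen.mem_nhds ((extChartAt (𝓡 2) p₀).map_source hp))).differentiableAt (by simp)
  have he : f =ᶠ[nhds p] (f ∘ (extChartAt (𝓡 2) p₀).symm) ∘ extChartAt (𝓡 2) p₀ := by
    filter_upwards [extChartAt_source_mem_nhds' hp] with q hq
    simp only [Function.comp_apply, (extChartAt (𝓡 2) p₀).left_inv hq]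
  have hφ : MDifferentiableAt (𝓡 2) 𝓘(ℝ, Plane) (extChartAt (𝓡 2) p₀) p :=
    mdifferentiableAt_extChartAt (by rwa [← extChartAt_source (I := 𝓡 2)])
  rw [he.mfderiv_eq, mfderiv_comp p hd.mdifferentiableAt hφ, mfderiv_eq_fderiv]
  rfl

/-- The differential of a chart is invertible, so reading `f` in a chart does not change the tangent
plane. All later differentiation can thus take place on open subsets of `Plane`. -/
theorem IsBetaSurface.isBetaPlane_chart {M : NeutralData W} {f : S → W} (hf : IsBetaSurface M f)
    (p₀ : S) {y : Plane} (hy : y ∈ (extChartAt (𝓡 2) p₀).target) :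
    IsBetaPlane M ((f ∘ (extChartAt (𝓡 2) p₀).symm) y)
      (fderiv ℝ (f ∘ (extChartAt (𝓡 2) p₀).symm) y) := by
  set φ := extChartAt (𝓡 2) p₀
  have hp : φ.symm y ∈ φ.source := φ.map_target hy
  obtain ⟨e, he⟩ := isInvertible_mfderiv_extChartAt hp
  have key (X : Plane) : fderiv ℝ (f ∘ φ.symm) y X =
      mfderiv (𝓡 2) 𝓘(ℝ, W) f (φ.symm y) (e.symm X) := by
    rw [mfderiv_eq_fderiv_comp_chart hf.2.1 hp, ← he, φ.right_inv hy]
    exact congrArg _ (e.apply_symm_apply X).symm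
  refine ⟨fun X Y h => ?_, fun σ hσ X Y => ?_⟩
  · rw [key, key] at h
    exact e.symm.injective (hf.2.2.1 _ h)
  · rw [key, key]
    exact hf.2.2.2 _ σ hσ _ _

/-- A property of the tangent planes which holds near each point in charts holds near each
point. -/
theorem eventually_of_chart {f : S → W} (hf : ContMDiff (𝓡 2) 𝓘(ℝ, W) ∞ f) (p₀ : S)
    {Q : W → W → Prop}
    (h : ∀ᶠ y in nhds (extChartAt (𝓡 2) p₀ p₀),
      ∀ X, Q ((f ∘ (extChartAt (𝓡 2) p₀).symm) y)
        (fderiv ℝ (f ∘ (extChartAt (𝓡 2) p₀).symm) y X)) :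
    ∀ᶠ p in nhds p₀, ∀ X, Q (f p) (mfderiv (𝓡 2) 𝓘(ℝ, W) f p X) := by
  filter_upwards [(continuousAt_extChartAt p₀).eventually h,
    extChartAt_source_mem_nhds (I := 𝓡 2) p₀] with p hp hs X
  rw [mfderiv_eq_fderiv_comp_chart hf hs]
  simpa only [Function.comp_apply, (extChartAt (𝓡 2) p₀).left_inv hs] using
    hp (mfderiv (𝓡 2) 𝓘(ℝ, Plane) (extChartAt (𝓡 2) p₀) p X)

/-- An immersed surface in `B` is relatively open in `B` if `B` admits linear coordinates near
each of its points, restricting to coordinates of the tangent plane. -/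
theorem isPieceOf_range {f : S → W} (hf : ContMDiff (𝓡 2) 𝓘(ℝ, W) ∞ f) {B : Set W}
    (hB : ∀ p, f p ∈ B)
    (h : ∀ p, ∃ G : W →L[ℝ] ℝ × ℝ, (∃ O ∈ nhds (f p), InjOn G (B ∩ O)) ∧
      ∀ X, G (mfderiv (𝓡 2) 𝓘(ℝ, W) f p X) = 0 → X = 0) :
    IsPieceOf (range f) B := by
  have loc (p : S) : ∃ U : Set W, IsOpen U ∧ f p ∈ U ∧ B ∩ U ⊆ range f := by
    obtain ⟨G, ⟨O, hO, hinj⟩, hG⟩ := h p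
    set φ := extChartAt (𝓡 2) p
    set y := φ p
    have hp : p ∈ φ.source := mem_extChartAt_source p
    have hc : ContDiffAt ℝ ∞ (f ∘ φ.symm) y :=
      (contDiffOn_comp_chart_symm hf p).contDiffAt
        ((isOpen_extChartAt_target p).mem_nhds (φ.map_source hp))
    have hs : HasStrictFDerivAt (G ∘ f ∘ φ.symm) (G ∘L fderiv ℝ (f ∘ φ.symm) y) y :=
      G.hasStrictFDerivAt.comp y (hc.hasStrictFDerivAt (by simp))
    obtain ⟨e, he⟩ := isInvertible_mfderiv_extChartAt hp
    -- Between spaces of dimension two an injective derivative is onto, so `G ∘ f` covers a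
    -- neighbourhood of `G (f p)`.
    have hinjd : Function.Injective (G ∘L fderiv ℝ (f ∘ φ.symm) y : Plane →L[ℝ] ℝ × ℝ) := by
      refine (injective_iff_map_eq_zero _).2 fun X hX => ?_
      have hX' : (e.symm X : TangentSpace (𝓡 2) p) = 0 := by
        apply hG
        rw [mfderiv_eq_fderiv_comp_chart hf hp, ← he]
        refine Eq.trans ?_ hX
        exact congrArg (fun Z => G (fderiv ℝ (f ∘ φ.symm) y Z)) (e.apply_symm_apply X)
      exact e.symm.map_eq_zero_iff.1 hX'
    have hsurj : (G ∘L fderiv ℝ (f ∘ φ.symm) y : Plane →L[ℝ] ℝ × ℝ).range = ⊤ := by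
      refine LinearMap.range_eq_top.2 ?_
      exact (LinearMap.injective_iff_surjective_of_finrank_eq_finrank
        (f := (G ∘L fderiv ℝ (f ∘ φ.symm) y : Plane →L[ℝ] ℝ × ℝ).toLinearMap)
        (by simp)).1 hinjd
    have hmap := hs.map_nhds_eq_of_surj hsurj
    have hy : (f ∘ φ.symm) y = f p := by simp [y, φ.left_inv hp]
    have hV : (f ∘ φ.symm) ⁻¹' O ∈ nhds y := hc.continuousAt.preimage_mem_nhds (by rwa [hy])
    have himg : (G ∘ f ∘ φ.symm) '' ((f ∘ φ.symm) ⁻¹' O) ∈ nhds (G (f p)) := by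
      have := Filter.image_mem_map (m := G ∘ f ∘ φ.symm) hV
      rw [hmap] at this
      rwa [Function.comp_apply, hy] at this
    have hN : G ⁻¹' ((G ∘ f ∘ φ.symm) '' ((f ∘ φ.symm) ⁻¹' O)) ∩ O ∈ nhds (f p) :=
      Filter.inter_mem (G.continuous.continuousAt.preimage_mem_nhds himg) hO
    obtain ⟨U, hUN, hU, hpU⟩ := mem_nhds_iff.1 hN
    refine ⟨U, hU, hpU, ?_⟩
    rintro q ⟨hqB, hqU⟩
    obtain ⟨⟨z, hz, hzq⟩, hqO⟩ := hUN hqU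
    -- A point of `B` near `f p` shares its `G`-value with a point of the surface, and `G` separates
    -- the points of `B ∩ O`.
    exact ⟨φ.symm z, hinj ⟨hB _, hz⟩ ⟨hqB, hqO⟩ hzq⟩
  choose U hU hpU hUB using loc
  refine ⟨⋃ p, U p, isOpen_iUnion hU, Subset.antisymm ?_ ?_⟩
  · rintro _ ⟨p, rfl⟩
    exact ⟨hB p, mem_iUnion.2 ⟨p, hpU p⟩⟩
  · rintro q ⟨hqB, hq⟩
    obtain ⟨p, hp⟩ := mem_iUnion.1 hq
    exact hUB p ⟨hqB, hp⟩

end Chart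

/-- Parameters which are determined pointwise up to an equivalence `B`, and can be chosen locally
constant, can be chosen constant. -/
theorem exists_global_parameter {S P α : Type*} [TopologicalSpace S] [ConnectedSpace S]
    {R : S → P → Prop} {B : P → α} (huniq : ∀ p a b, R p a → R p b → B a = B b)
    (hloc : ∀ p, ∃ a, ∀ᶠ q in nhds p, R q a) :
    ∃ a, (∃ p, R p a) ∧ ∀ p, ∃ b, R p b ∧ B b = B a := by
  choose a ha using hloc
  have hlc : IsLocallyConstant fun p => B (a p) := by
    rw [IsLocallyConstant.iff_eventually_eq]
    intro p
    -- At a nearby `q`, both the parameter chosen for `p` and the one chosen for `q` are admissible,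
    -- so their `B`-classes agree.
    filter_upwards [ha p] with q hq
    exact huniq q _ _ (ha q).self_of_nhds hq
  obtain ⟨p₀⟩ := (inferInstance : Nonempty S)
  exact ⟨a p₀, ⟨p₀, (ha p₀).self_of_nhds⟩, fun p => ⟨a p, (ha p).self_of_nhds,
    hlc.apply_eq_of_preconnectedSpace p p₀⟩⟩

/-! ### Constancy of the conormal -/

section Conormal

variable {E V : Type*} [NormedAddCommGroup E] [NormedSpace ℝ E] [NormedAddCommGroup V]
  [NormedSpace ℝ V]

/-- Differentiating `b (n, dF Y) = 0` along `Z` gives `b (dn Z, dF Y) + b (n, D²F (Z, Y)) = 0`, and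
the second term is symmetric in `Y` and `Z`. -/
theorem conormal_symm (b : V →L[ℝ] V →L[ℝ] ℝ) {n F : E → V} {y : E}
    (hn : DifferentiableAt ℝ n y) (hF : ContDiffAt ℝ ∞ F y)
    (h : ∀ᶠ z in nhds y, ∀ Y, b (n z) (fderiv ℝ F z Y) = 0) (Y Z : E) :
    b (fderiv ℝ n y Z) (fderiv ℝ F y Y) = b (fderiv ℝ n y Y) (fderiv ℝ F y Z) := by
  have hF' : DifferentiableAt ℝ (fderiv ℝ F) y :=
    (hF.fderiv_right (m := 1) (by norm_cast)).differentiableAt (by simp)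
  have key (Y Z : E) : b (fderiv ℝ n y Z) (fderiv ℝ F y Y) +
      b (n y) (fderiv ℝ (fderiv ℝ F) y Z Y) = 0 := by
    have h1 : HasFDerivAt (fun z => b (n z)) (b ∘L fderiv ℝ n y) y :=
      b.hasFDerivAt.comp y hn.hasFDerivAt
    have h2 : HasFDerivAt (fun z => fderiv ℝ F z Y)
        ((ContinuousLinearMap.apply ℝ V Y) ∘L fderiv ℝ (fderiv ℝ F) y) y :=
      (ContinuousLinearMap.apply ℝ V Y).hasFDerivAt.comp y hF'.hasFDerivAt
    have h3 := h1.clm_apply h2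
    have h4 : HasFDerivAt (fun z => b (n z) (fderiv ℝ F z Y)) (0 : E →L[ℝ] ℝ) y :=
      (hasFDerivAt_const (0 : ℝ) y).congr_of_eventuallyEq (h.mono fun z hz => hz Y)
    have h5 := congrArg (fun L => L Z) (h3.unique h4)
    simpa [add_comm] using h5
  have hs := (hF.isSymmSndFDerivAt (by
    simp only [minSmoothness_of_isRCLikeNormedField]
    exact WithTop.coe_le_coe.2 (le_top : (2 : ℕ∞) ≤ ⊤))) Y Z
  have h1 := key Y Z
  have h2 := key Z Y
  rw [hs] at h2
  linarith

/-- `conormal_symm` is applied twice. With `F₁`, the vanishing of `dF₁ Z` makes `dn Z` orthogonal to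
`dF₁ X`, hence zero. With `F₂`, this in turn makes every `dn Y` orthogonal to `dF₂ Z`, hence zero.
The last two hypotheses say that the other constraints on `dn` leave one degree of freedom, which
either pairing detects. -/
theorem fderiv_conormal_eq_zero (b : V →L[ℝ] V →L[ℝ] ℝ) {n F₁ F₂ : E → V} {y : E}
    (hn : DifferentiableAt ℝ n y) (hF₁ : ContDiffAt ℝ ∞ F₁ y) (hF₂ : ContDiffAt ℝ ∞ F₂ y)
    (h₁ : ∀ᶠ z in nhds y, ∀ Y, b (n z) (fderiv ℝ F₁ z Y) = 0)
    (h₂ : ∀ᶠ z in nhds y, ∀ Y, b (n z) (fderiv ℝ F₂ z Y) = 0)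
    {X Z : E} (hZ : fderiv ℝ F₁ y Z = 0)
    (hX' : ∀ Y, b (fderiv ℝ n y Y) (fderiv ℝ F₁ y X) = 0 → fderiv ℝ n y Y = 0)
    (hZ' : ∀ Y, b (fderiv ℝ n y Y) (fderiv ℝ F₂ y Z) = 0 → fderiv ℝ n y Y = 0) :
    fderiv ℝ n y = 0 := by
  have hnZ : fderiv ℝ n y Z = 0 := by
    apply hX'
    rw [conormal_symm b hn hF₁ h₁, hZ, map_zero]
  ext1 Y
  apply hZ'
  rw [conormal_symm b hn hF₂ h₂, hnZ, map_zero, zero_apply]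

end Conormal

/-! ### Linear algebra of β-planes -/

theorem exists_ne_zero_map_eq_zero {V : Type*} [AddCommGroup V] [Module ℝ V]
    (A : Plane →ₗ[ℝ] V) (h : ∀ X Y, A X ≠ 0 → ∃ r : ℝ, A Y = r • A X) : ∃ Z, Z ≠ 0 ∧ A Z = 0 := by
  by_contra! hA
  have hi (i : Fin 2) : EuclideanSpace.single i (1 : ℝ) ≠ 0 := by simp
  obtain ⟨r, hr⟩ := h (EuclideanSpace.single 0 1) (EuclideanSpace.single 1 1) (hA _ (hi 0))
  have h0 : EuclideanSpace.single 1 1 - r • EuclideanSpace.single 0 (1 : ℝ) ≠ (0 : Plane) := by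
    intro h
    simpa using congrArg (fun v : Plane => v 1) h
  exact hA _ h0 (by simp [hr])

/-- `Z` spans `ker A` and `X` spans `ker B`; joint injectivity makes the other map nonzero on each.
Every `B Y` is a multiple of `B Z`, and symmetry turns `μ (A X, B Z)` into `μ (A Z, B X) = 0`. -/
theorem rank_one_pair {V : Type*} [AddCommGroup V] [Module ℝ V] (A B : Plane →ₗ[ℝ] V)
    (hA : ∀ X Y, A X ≠ 0 → ∃ r : ℝ, A Y = r • A X) (hB : ∀ X Y, B X ≠ 0 → ∃ r : ℝ, B Y = r • B X)
    (hAB : ∀ X, A X = 0 → B X = 0 → X = 0) {μ : V → V → ℝ}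
    (hμ0 : ∀ u, μ 0 u = 0) (hμs : ∀ u v (r : ℝ), μ u (r • v) = r * μ u v)
    (hμ : ∀ X Y, μ (A X) (B Y) = μ (A Y) (B X)) :
    ∃ X Z, A X ≠ 0 ∧ A Z = 0 ∧ B Z ≠ 0 ∧ ∀ X Y, μ (A X) (B Y) = 0 := by
  obtain ⟨Z, hZ, hAZ⟩ := exists_ne_zero_map_eq_zero A hA
  obtain ⟨X, hX, hBX⟩ := exists_ne_zero_map_eq_zero B hB
  have hBZ : B Z ≠ 0 := fun h => hZ (hAB Z hAZ h)
  refine ⟨X, Z, fun h => hX (hAB X h hBX), hAZ, hBZ, fun X Y => ?_⟩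
  obtain ⟨r, hr⟩ := hB Z Y hBZ
  rw [hr, hμs, hμ, hAZ, hμ0, mul_zero]

/-! ### Vector algebra in `𝔼³` and `𝔼³₁` -/

theorem det3_eq (a b c : V3) : det3 a b c = a 0 * (b 1 * c 2 - b 2 * c 1) +
    a 1 * (b 2 * c 0 - b 0 * c 2) + a 2 * (b 0 * c 1 - b 1 * c 0) := by
  simp [det3, cross_apply, dotProduct, Fin.sum_univ_three]

theorem rot_apply_zero (ε : ℝ) (x a : V3) : rot ε x a 0 = x 1 * a 2 - x 2 * a 1 := by
  simp [rot, cross_apply]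

theorem rot_apply_one (ε : ℝ) (x a : V3) : rot ε x a 1 = x 2 * a 0 - x 0 * a 2 := by
  simp [rot, cross_apply]

theorem rot_apply_two (ε : ℝ) (x a : V3) : rot ε x a 2 = ε * (x 0 * a 1 - x 1 * a 0) := by
  simp [rot, cross_apply]

theorem V3.ext {a b : V3} (h0 : a 0 = b 0) (h1 : a 1 = b 1) (h2 : a 2 = b 2) : a = b := by
  funext i; fin_cases i <;> assumption

/-- A bilinear form on a finite-dimensional space as a continuous bilinear form. -/
def bilinCLM {V : Type*} [NormedAddCommGroup V] [NormedSpace ℝ V] [FiniteDimensional ℝ V]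
    (b : V →ₗ[ℝ] V →ₗ[ℝ] ℝ) : V →L[ℝ] V →L[ℝ] ℝ :=
  LinearMap.toContinuousLinearMap
    ((LinearMap.toContinuousLinearMap : (V →ₗ[ℝ] ℝ) ≃ₗ[ℝ] (V →L[ℝ] ℝ)).toLinearMap ∘ₗ b)

/-- `ip` as a continuous bilinear form. -/
def ipL (ε : ℝ) : V3 →L[ℝ] V3 →L[ℝ] ℝ :=
  bilinCLM (LinearMap.mk₂ ℝ (ip ε) (by intros; simp [ip]; ring) (by intros; simp [ip]; ring)
    (by intros; simp [ip]; ring) (by intros; simp [ip]; ring))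

@[simp]
theorem ipL_apply (ε : ℝ) (x y : V3) : ipL ε x y = ip ε x y := rfl

theorem ip_comm (ε : ℝ) (x y : V3) : ip ε x y = ip ε y x := by simp only [ip]; ring

theorem ip_smul_left (ε r : ℝ) (x y : V3) : ip ε (r • x) y = r * ip ε x y := by
  simp [ip]; ring

theorem ip_smul_right (ε r : ℝ) (x y : V3) : ip ε x (r • y) = r * ip ε x y := by
  simp [ip]; ring

theorem ip_add_left (ε : ℝ) (x x' y : V3) : ip ε (x + x') y = ip ε x y + ip ε x' y := by
  simp [ip]; ring

theorem ip_add_right (ε : ℝ) (x y y' : V3) : ip ε x (y + y') = ip ε x y + ip ε x y' := by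
  simp [ip]; ring

theorem ip_sub_left (ε : ℝ) (x x' y : V3) : ip ε (x - x') y = ip ε x y - ip ε x' y := by
  simp [ip]; ring

theorem ip_sub_right (ε : ℝ) (x y y' : V3) : ip ε x (y - y') = ip ε x y - ip ε x y' := by
  simp [ip]; ring

theorem ip_zero_left (ε : ℝ) (y : V3) : ip ε 0 y = 0 := by simp [ip]

theorem ip_zero_right (ε : ℝ) (y : V3) : ip ε y 0 = 0 := by simp [ip]

theorem det3_smul_right (r : ℝ) (a b c : V3) : det3 a b (r • c) = r * det3 a b c := by
  simp [det3_eq]; ring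

theorem det3_self_right (a b : V3) : det3 a b b = 0 := by simp only [det3_eq]; ring

theorem det3_swap (a b c : V3) : det3 a c b = -det3 a b c := by simp only [det3_eq]; ring

/-- Cramer's rule; the sign `ε` only affects the third coordinate. This serves throughout to prove
vector identities by testing against a basis. -/
theorem eq_zero_of_ip_eq_zero {ε : ℝ} (hε : ε * ε = 1) {a b c r : V3} (h : det3 a b c ≠ 0)
    (ha : ip ε r a = 0) (hb : ip ε r b = 0) (hc : ip ε r c = 0) : r = 0 := by
  rw [det3_eq] at h
  simp only [ip] at ha hb hc
  refine V3.ext ?_ ?_ ?_ <;> refine (mul_eq_zero.1 ?_).resolve_left h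
  · linear_combination (b 1 * c 2 - b 2 * c 1) * ha + (c 1 * a 2 - c 2 * a 1) * hb +
      (a 1 * b 2 - a 2 * b 1) * hc
  · linear_combination (b 2 * c 0 - b 0 * c 2) * ha + (c 2 * a 0 - c 0 * a 2) * hb +
      (a 2 * b 0 - a 0 * b 2) * hc
  · linear_combination ε * ((b 0 * c 1 - b 1 * c 0) * ha + (c 0 * a 1 - c 1 * a 0) * hb +
      (a 0 * b 1 - a 1 * b 0) * hc) - (r 2 * (a 0 * (b 1 * c 2 - b 2 * c 1) +
    a 1 * (b 2 * c 0 - b 0 * c 2) + a 2 * (b 0 * c 1 - b 1 * c 0))) * hε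

section Base

variable {ε : ℝ}

theorem ip_rot_self_left (hε : ε * ε = 1) (x a : V3) : ip ε x (rot ε x a) = 0 := by
  rw [ip_comm, ip_rot ε hε, det3_eq]; ring

theorem ip_rot_self_right (hε : ε * ε = 1) (x a : V3) : ip ε a (rot ε x a) = 0 := by
  rw [ip_comm, ip_rot ε hε, det3_eq]; ring

theorem ip_rot_rot (hε : ε * ε = 1) {x a : V3} (hx : ip ε x x = ε) (ha : ip ε x a = 0) :
    ip ε (rot ε x a) (rot ε x a) = ip ε a a := by
  have h : ip ε (rot ε x a) (rot ε x a) = ε * (ip ε x x * ip ε a a - ip ε x a * ip ε x a) := by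
    simp only [ip, rot_apply_zero, rot_apply_one, rot_apply_two]
    linear_combination (ε * (x 0 * a 1 - x 1 * a 0) ^ 2 -
      (x 1 * a 2 - x 2 * a 1) ^ 2 - (x 2 * a 0 - x 0 * a 2) ^ 2) * hε
  rw [h, hx, ha]
  linear_combination ip ε a a * hε

theorem rot_rot (hε : ε * ε = 1) {x a : V3} (hx : ip ε x x = ε) (ha : ip ε x a = 0) :
    rot ε x (rot ε x a) = -a := by
  simp only [ip] at hx ha
  refine V3.ext ?_ ?_ ?_ <;>
    simp only [rot_apply_zero, rot_apply_one, rot_apply_two, Pi.neg_apply]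
  · linear_combination (ε * x 0) * ha - (ε * a 0) * hx - (a 0 - x 2 * (a 0 * x 2 - a 2 * x 0)) * hε
  · linear_combination (ε * x 1) * ha - (ε * a 1) * hx - (a 1 - x 2 * (a 1 * x 2 - a 2 * x 1)) * hε
  · linear_combination (ε * x 2) * ha - (ε * a 2) * hx - a 2 * hε

/-- For `ε = -1` this says that the orthogonal complement of a time-like vector is space-like. It
follows from the Cauchy–Schwarz inequality in the first two coordinates. -/
theorem ip_self_pos (hε : ε = 1 ∨ ε = -1) {x a : V3} (hx : x ∈ baseSurface ε)
    (ha : ip ε x a = 0) (h0 : a ≠ 0) : 0 < ip ε a a := by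
  have hx1 := hx.1
  have hx2 := hx.2
  rcases hε with rfl | rfl
  · simp only [ip] at *
    by_contra! h
    apply h0
    refine V3.ext ?_ ?_ ?_ <;> simp only [Pi.zero_apply] <;>
      nlinarith [sq_nonneg (a 0), sq_nonneg (a 1), sq_nonneg (a 2)]
  · have hpos : 0 < x 2 := hx2 (by norm_num)
    simp only [ip] at *
    by_contra! h
    have h1 : (x 0 * a 0 + x 1 * a 1) ^ 2 ≤ (x 0 ^ 2 + x 1 ^ 2) * (a 0 ^ 2 + a 1 ^ 2) := by
      nlinarith [sq_nonneg (x 0 * a 1 - x 1 * a 0)]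
    have h2 : x 0 * a 0 + x 1 * a 1 = x 2 * a 2 := by linarith
    have h3 : x 0 ^ 2 + x 1 ^ 2 = x 2 ^ 2 - 1 := by linarith
    rw [h2, h3] at h1
    have h4 : a 0 ^ 2 + a 1 ^ 2 ≤ a 2 ^ 2 := by linarith
    have h5 : a 0 ^ 2 + a 1 ^ 2 ≤ 0 := by nlinarith [mul_le_mul_of_nonneg_left h4 (sq_nonneg (x 2))]
    have ha0 : a 0 = 0 := by nlinarith [sq_nonneg (a 0), sq_nonneg (a 1)]
    have ha1 : a 1 = 0 := by nlinarith [sq_nonneg (a 0), sq_nonneg (a 1)]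
    have ha2 : a 2 = 0 := by
      rw [ha0, ha1] at h2
      simpa [hpos.ne'] using h2.symm
    exact h0 (V3.ext ha0 ha1 ha2)

/-- Planar Cauchy–Schwarz bounds the square of the spatial part by `(x₂² - 1)(y₂² - 1)`, which is
less than `(x₂ y₂)²`. -/
theorem ip_neg_of_mem {x y : V3} (hx : x ∈ baseSurface (-1)) (hy : y ∈ baseSurface (-1)) :
    ip (-1) x y < 0 := by
  obtain ⟨hx1, hx2⟩ := hx
  obtain ⟨hy1, hy2⟩ := hy
  have hx2 : 0 < x 2 := hx2 (by norm_num)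
  have hy2 : 0 < y 2 := hy2 (by norm_num)
  simp only [ip] at *
  have h1 : (x 0 * y 0 + x 1 * y 1) ^ 2 ≤ (x 0 ^ 2 + x 1 ^ 2) * (y 0 ^ 2 + y 1 ^ 2) := by
    nlinarith [sq_nonneg (x 0 * y 1 - x 1 * y 0)]
  have h2 : x 0 ^ 2 + x 1 ^ 2 = x 2 ^ 2 - 1 := by linarith
  have h3 : y 0 ^ 2 + y 1 ^ 2 = y 2 ^ 2 - 1 := by linarith
  rw [h2, h3] at h1
  have hx3 : 1 ≤ x 2 ^ 2 := by nlinarith [sq_nonneg (x 0), sq_nonneg (x 1)]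
  have hy3 : 1 ≤ y 2 ^ 2 := by nlinarith [sq_nonneg (y 0), sq_nonneg (y 1)]
  have h4 : (x 0 * y 0 + x 1 * y 1) ^ 2 < (x 2 * y 2) ^ 2 := by nlinarith
  have h5 := (le_abs_self _).trans_lt (abs_lt_of_sq_lt_sq h4 (by positivity))
  linarith

theorem exists_unit_tangent (hε : ε = 1 ∨ ε = -1) {x : V3} (hx : x ∈ baseSurface ε) :
    ∃ a, ip ε x a = 0 ∧ ip ε a a = 1 := by
  obtain ⟨u, hu, hu0⟩ : ∃ u, ip ε x u = 0 ∧ u ≠ 0 := by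
    by_cases h : x 0 = 0
    · exact ⟨![1, 0, 0], by simp [ip, h], fun h => by simpa using congrFun h 0⟩
    · exact ⟨![-x 1, x 0, 0], by simp [ip]; ring, fun h' => h (by simpa using congrFun h' 1)⟩
  have hpos := ip_self_pos hε hx hu hu0
  refine ⟨(√(ip ε u u))⁻¹ • u, by rw [ip_smul_right, hu, mul_zero], ?_⟩
  rw [ip_smul_left, ip_smul_right, ← mul_assoc, ← mul_inv, Real.mul_self_sqrt hpos.le,
    inv_mul_cancel₀ hpos.ne']

theorem mul_self_of_eq (hε : ε = 1 ∨ ε = -1) : ε * ε = 1 := by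
  rcases hε with rfl | rfl <;> norm_num

/-- The vectors `x`, `a`, `rot ε x a` form an orthogonal basis. Subtracting from `u` its projection
to `a` leaves a vector orthogonal to all three. -/
theorem parallel_of_det3 (hε : ε = 1 ∨ ε = -1) {x a u : V3} (hx : x ∈ baseSurface ε)
    (ha : ip ε x a = 0) (hu : ip ε x u = 0) (ha0 : a ≠ 0) (h : det3 x a u = 0) :
    ∃ r : ℝ, u = r • a := by
  have hε' := mul_self_of_eq hε
  have hpos := ip_self_pos hε hx ha ha0
  refine ⟨ip ε a u / ip ε a a, sub_eq_zero.1 ?_⟩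
  refine eq_zero_of_ip_eq_zero hε' (a := x) (b := a) (c := rot ε x a) ?_ ?_ ?_ ?_
  · rw [← ip_rot ε hε', ip_rot_rot hε' hx.1 ha]; exact hpos.ne'
  · rw [ip_comm, ip_sub_right, hu, ip_smul_right, ha]; ring
  · rw [ip_sub_left, ip_smul_left, ip_comm ε u a]; field_simp; ring
  · rw [ip_comm, ip_sub_right, ip_rot ε hε', h, ip_smul_right, ip_rot ε hε', det3_self_right]; ring

/-- The vectors orthogonal to `x` and to a tangent vector `a` are multiples of `rot x a`. -/
theorem eq_smul_rot (hε : ε = 1 ∨ ε = -1) {x a u : V3} (hx : x ∈ baseSurface ε)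
    (ha : ip ε x a = 0) (ha0 : a ≠ 0) (hu : ip ε x u = 0) (hau : ip ε a u = 0) :
    ∃ r : ℝ, u = r • rot ε x a := by
  have hε' := mul_self_of_eq hε
  refine parallel_of_det3 hε hx (ip_rot_self_left hε' x a) hu ?_ ?_
  · intro h
    have := ip_rot_rot hε' hx.1 ha
    rw [h, ip_zero_left] at this
    exact (ip_self_pos hε hx ha ha0).ne this
  · rw [← ip_rot ε hε', rot_rot hε' hx.1 ha, ← neg_one_smul ℝ a, ip_smul_left, hau, mul_zero]

/-! ### Horizontal and vertical parts, and a unitary frame of `TN` -/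

theorem ip_vert (hε : ε * ε = 1) {x : V3} (hx : ip ε x x = ε) (b : V3) :
    ip ε x (vert ε x b) = 0 := by
  rw [vert, ip_sub_right, ip_smul_right, hx]
  linear_combination -ip ε x b * hε

theorem det3_vert_right (x a b : V3) : det3 x a (vert ε x b) = det3 x a b := by
  simp [vert, det3_eq]; ring

theorem vert_eq_self {x b : V3} (h : ip ε x b = 0) : vert ε x b = b := by simp [vert, h]

/-- `vert` as a linear map. -/
def vertL (ε : ℝ) (x : V3) : V3 →ₗ[ℝ] V3 where
  toFun := vert ε x
  map_add' b b' := by simp only [vert, ip_add_right]; module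
  map_smul' r b := by simp only [vert, ip_smul_right, RingHom.id_apply]; module

/-- The tangent vector of `TN` at `p` with given horizontal and vertical parts. -/
def lift (ε : ℝ) (p : V3 × V3) (a b : V3) : V3 × V3 := (a, b - (ε * ip ε a p.2) • p.1)

theorem vert_lift (hε : ε * ε = 1) {p : V3 × V3} (hp : ip ε p.1 p.1 = ε) (a : V3) {b : V3}
    (hb : ip ε p.1 b = 0) : vert ε p.1 (lift ε p a b).2 = b := by
  simp only [vert, lift, ip_sub_right, ip_smul_right, hp, hb]
  rw [sub_sub, ← add_smul, show ε * ip ε a p.2 + ε * (0 - ε * ip ε a p.2 * ε) = 0 by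
    linear_combination (-ε * ip ε a p.2) * hε, zero_smul, sub_zero]

theorem lift_mem_tangent (hε : ε * ε = 1) {p : V3 × V3} (hp : ip ε p.1 p.1 = ε) {a b : V3}
    (ha : ip ε p.1 a = 0) (hb : ip ε p.1 b = 0) : lift ε p a b ∈ tangentTN ε p := by
  refine ⟨ha, ?_⟩
  simp only [lift, ip_sub_right, ip_smul_right, hp, hb]
  linear_combination -ip ε a p.2 * hε

/-- The unitary frame of `TN` at `p` determined by a unit tangent vector `a` of `N`. -/
def frameTN (ε : ℝ) (p : V3 × V3) (a : V3) : Fin 4 → V3 × V3 :=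
  ![lift ε p a (-(1 / 2 : ℝ) • rot ε p.1 a), lift ε p (rot ε p.1 a) ((1 / 2 : ℝ) • a),
    lift ε p a ((1 / 2 : ℝ) • rot ε p.1 a), lift ε p (rot ε p.1 a) (-(1 / 2 : ℝ) • a)]

theorem rot_smul (x a : V3) (r : ℝ) : rot ε x (r • a) = r • rot ε x a := by
  refine V3.ext ?_ ?_ ?_ <;>
    simp only [rot_apply_zero, rot_apply_one, rot_apply_two, Pi.smul_apply, smul_eq_mul] <;> ring

theorem frameTN_vert (hε : ε * ε = 1) {p : V3 × V3} (hp : ip ε p.1 p.1 = ε) {a : V3}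
    (ha : ip ε p.1 a = 0) :
    vert ε p.1 (frameTN ε p a 0).2 = -(1 / 2 : ℝ) • rot ε p.1 a ∧
    vert ε p.1 (frameTN ε p a 1).2 = (1 / 2 : ℝ) • a ∧
    vert ε p.1 (frameTN ε p a 2).2 = (1 / 2 : ℝ) • rot ε p.1 a ∧
    vert ε p.1 (frameTN ε p a 3).2 = -(1 / 2 : ℝ) • a := by
  have hj := ip_rot_self_left hε p.1 a
  refine ⟨vert_lift hε hp _ ?_, vert_lift hε hp _ ?_, vert_lift hε hp _ ?_, vert_lift hε hp _ ?_⟩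
    <;> simp only [ip_smul_right, ha, hj, mul_zero]

/-- The square of a tangent vector is `2 dA (∇v, ẋ)`. Hence horizontal part `a` with vertical part
`∓½ j a` has square `±1`, and applying `j` to both parts gives the partner of the same sign. -/
theorem isUnitaryFrame_frameTN (hε : ε * ε = 1) {p : V3 × V3} (hp : ip ε p.1 p.1 = ε) {a : V3}
    (ha : ip ε p.1 a = 0) (ha1 : ip ε a a = 1) :
    IsUnitaryFrame (tangentBundleData ε) p (frameTN ε p a) := by
  have hj := ip_rot_self_left hε p.1 a
  have hj1 : det3 p.1 a (rot ε p.1 a) = 1 := by rw [← ip_rot ε hε, ip_rot_rot hε hp ha, ha1]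
  have hj2 : det3 p.1 (rot ε p.1 a) a = -1 := by rw [det3_swap, hj1]
  obtain ⟨v0, v1, v2, v3⟩ := frameTN_vert hε hp ha
  have det_smul_mid (r : ℝ) (u v : V3) : det3 p.1 (r • u) v = r * det3 p.1 u v := by
    simp [det3_eq]; ring
  refine ⟨?_, ?_, ?_, ?_⟩
  · have hl {a b : V3} (ha : ip ε p.1 a = 0) (hb : ip ε p.1 b = 0) :
        lift ε p a b ∈ (tangentBundleData ε).tangent p := lift_mem_tangent hε hp ha hb
    intro i
    fin_cases i <;> refine hl ?_ ?_ <;> simp only [ip_smul_right, ha, hj, mul_zero]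
  · have h0 : (frameTN ε p a 0).1 = a := rfl
    have h1 : (frameTN ε p a 1).1 = rot ε p.1 a := rfl
    have h2 : (frameTN ε p a 2).1 = a := rfl
    have h3 : (frameTN ε p a 3).1 = rot ε p.1 a := rfl
    simp only [tangentBundleData]
    simp only [Fin.forall_fin_succ, IsEmpty.forall_iff, and_true, Fin.succ_zero_eq_one,
      Fin.succ_one_eq_two, Fin.isValue, Fin.reduceSucc, v0, v1, v2, v3, h0, h1, h2, h3,
      det_smul_mid, hj1, hj2, det3_self_right]
    have s0 : sig 0 = 1 := rfl
    have s1 : sig 1 = 1 := rfl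
    have s2 : sig 2 = -1 := rfl
    have s3 : sig 3 = -1 := rfl
    norm_num +decide [s0, s1, s2, s3]
  · change (rot ε p.1 a, rot ε p.1 (vert ε p.1 (frameTN ε p a 0).2) - _) = lift ε p _ _
    rw [v0, rot_smul, rot_rot hε hp ha, smul_neg, neg_smul, neg_neg]
    rfl
  · change (rot ε p.1 a, rot ε p.1 (vert ε p.1 (frameTN ε p a 2).2) - _) = lift ε p _ _
    rw [v2, rot_smul, rot_rot hε hp ha, smul_neg, ← neg_smul]
    rfl

end Base

/-! ### β-planes of `TN` -/

section PlaneTN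

variable {ε : ℝ}

theorem det3_add_mid (a b b' c : V3) : det3 a (b + b') c = det3 a b c + det3 a b' c := by
  simp [det3_eq]; ring

theorem det3_add_right (a b c c' : V3) : det3 a b (c + c') = det3 a b c + det3 a b c' := by
  simp [det3_eq]; ring

theorem det3_smul_mid (r : ℝ) (a b c : V3) : det3 a (r • b) c = r * det3 a b c := by
  simp [det3_eq]; ring

/-- `det3 x` as a bilinear form. -/
def det3L (x : V3) : V3 →ₗ[ℝ] V3 →ₗ[ℝ] ℝ :=
  LinearMap.mk₂ ℝ (det3 x) (det3_add_mid x) (fun r => det3_smul_mid r x) (det3_add_right x)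
    (fun r => det3_smul_right r x)

/-- The three anti-self-duality equations are checked in `frameTN`. Only this inclusion is used, not
that these combinations exhaust the anti-self-dual forms. -/
theorem isAntiSelfDual_TN (hε : ε = 1 ∨ ε = -1) {p : V3 × V3} (hp : p.1 ∈ baseSurface ε)
    {s₁ s₂ s₃ : ℝ} {σ : LinearMap.BilinForm ℝ (V3 × V3)}
    (hσ : ∀ X Y, σ X Y = s₁ * det3 p.1 X.1 Y.1 +
      s₂ * det3 p.1 (vert ε p.1 X.2) (vert ε p.1 Y.2) +
      s₃ * (det3 p.1 X.1 (vert ε p.1 Y.2) + det3 p.1 (vert ε p.1 X.2) Y.1)) :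
    IsAntiSelfDual (tangentBundleData ε) p σ := by
  have hε' := mul_self_of_eq hε
  obtain ⟨a, ha, ha1⟩ := exists_unit_tangent hε hp
  have halt : σ.IsAlt := fun X => by
    rw [hσ, det3_swap p.1 X.1 (vert ε p.1 X.2), det3_self_right, det3_self_right]; ring
  refine ⟨halt, frameTN ε p a, isUnitaryFrame_frameTN hε' hp.1 ha ha1, ?_⟩
  rw [antiSelfDual_iff _ _ halt]
  obtain ⟨v0, v1, v2, v3⟩ := frameTN_vert hε' hp.1 ha
  have h0 : (frameTN ε p a 0).1 = a := rfl
  have h1 : (frameTN ε p a 1).1 = rot ε p.1 a := rfl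
  have h2 : (frameTN ε p a 2).1 = a := rfl
  have h3 : (frameTN ε p a 3).1 = rot ε p.1 a := rfl
  have hs := det3_swap p.1 a (rot ε p.1 a)
  simp only [hσ, v0, v1, v2, v3, h0, h1, h2, h3, det3_smul_mid, det3_smul_right,
    det3_self_right, hs]
  refine ⟨?_, ?_, ?_⟩ <;> ring

theorem isBetaPlane_TN (hε : ε = 1 ∨ ε = -1) {p : V3 × V3} (hp : p.1 ∈ baseSurface ε)
    {L : Plane →L[ℝ] V3 × V3} (hL : IsBetaPlane (tangentBundleData ε) p L) (X Y : Plane) :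
    det3 p.1 (L X).1 (L Y).1 = 0 ∧
    det3 p.1 (vert ε p.1 (L X).2) (vert ε p.1 (L Y).2) = 0 ∧
    det3 p.1 (L X).1 (vert ε p.1 (L Y).2) = det3 p.1 (L Y).1 (vert ε p.1 (L X).2) := by
  let d (f g : V3 × V3 →ₗ[ℝ] V3) : LinearMap.BilinForm ℝ (V3 × V3) := (det3L p.1).compl₁₂ f g
  let F := LinearMap.fst ℝ V3 V3
  -- `F` and `G` extract horizontal and vertical parts; the three test forms correspond to the unit
  -- choices of `(s₁, s₂, s₃)`.
  let G := vertL ε p.1 ∘ₗ LinearMap.snd ℝ V3 V3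
  have h1 := hL.2 (d F F) (isAntiSelfDual_TN hε hp (s₁ := 1) (s₂ := 0) (s₃ := 0) fun X Y => by
    rw [one_mul, zero_mul, zero_mul, add_zero, add_zero]; rfl) X Y
  have h2 := hL.2 (d G G) (isAntiSelfDual_TN hε hp (s₁ := 0) (s₂ := 1) (s₃ := 0) fun X Y => by
    rw [one_mul, zero_mul, zero_mul, add_zero, zero_add]; rfl) X Y
  have h3 := hL.2 (d F G + d G F) (isAntiSelfDual_TN hε hp (s₁ := 0) (s₂ := 0) (s₃ := 1)
    fun X Y => by rw [one_mul, zero_mul, zero_mul, zero_add, zero_add]; rfl) X Y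
  refine ⟨h1, h2, ?_⟩
  have h4 : det3 p.1 (L X).1 (vert ε p.1 (L Y).2) + det3 p.1 (vert ε p.1 (L X).2) (L Y).1 = 0 := h3
  rw [det3_swap p.1 (L Y).1] at h4
  linarith

/-- The tangent planes of β-surfaces are spanned by a horizontal and a vertical vector with the
same direction. -/
theorem IsBetaPlane.exists_direction_TN (hε : ε = 1 ∨ ε = -1) {p : V3 × V3}
    (hp : p.1 ∈ baseSurface ε) {L : Plane →L[ℝ] V3 × V3}
    (hL : IsBetaPlane (tangentBundleData ε) p L) (hT : ∀ X, L X ∈ tangentTN ε p) :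
    ∃ X Z, (L X).1 ≠ 0 ∧ (L Z).1 = 0 ∧ (L Z).2 ≠ 0 ∧
      ∀ X Y, det3 p.1 (L X).1 (L Y).1 = 0 ∧ det3 p.1 (L X).1 (L Y).2 = 0 := by
  have hε' := mul_self_of_eq hε
  let A : Plane →ₗ[ℝ] V3 := LinearMap.fst ℝ V3 V3 ∘ₗ L.toLinearMap
  let B : Plane →ₗ[ℝ] V3 := vertL ε p.1 ∘ₗ LinearMap.snd ℝ V3 V3 ∘ₗ L.toLinearMap
  have hv {X} (h : (L X).1 = 0) : B X = (L X).2 := by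
    apply vert_eq_self
    simpa [h, ip_zero_left] using (hT X).2
  obtain ⟨X, Z, hX, hZ, hZ', h⟩ := rank_one_pair A B (μ := det3 p.1)
    (fun X Y hX => parallel_of_det3 hε hp (hT X).1 (hT Y).1 hX (isBetaPlane_TN hε hp hL X Y).1)
    (fun X Y hX => parallel_of_det3 hε hp (ip_vert hε' hp.1 _) (ip_vert hε' hp.1 _) hX
      (isBetaPlane_TN hε hp hL X Y).2.1)
    (fun X hA hB => by
      refine hL.1 ((Prod.ext hA ?_).trans (map_zero L).symm)
      exact (hv hA).symm.trans hB)
    (fun u => by simp [det3_eq]) (fun u v r => det3_smul_right r _ u v)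
    (fun X Y => (isBetaPlane_TN hε hp hL X Y).2.2)
  refine ⟨X, Z, hX, hZ, hv hZ ▸ hZ', fun X Y => ⟨(isBetaPlane_TN hε hp hL X Y).1, ?_⟩⟩
  rw [← det3_vert_right (ε := ε)]
  exact h X Y

end PlaneTN

/-! ### β-surfaces of `TN` -/

section LocalTN

variable {ε : ℝ}

theorem differentiableAt_ip {f g : Plane → V3} {y : Plane} (hf : DifferentiableAt ℝ f y)
    (hg : DifferentiableAt ℝ g y) : DifferentiableAt ℝ (fun z => ip ε (f z) (g z)) y := by
  simp only [ip]
  fun_prop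

theorem fderiv_ip {f g : Plane → V3} {y : Plane} (hf : DifferentiableAt ℝ f y)
    (hg : DifferentiableAt ℝ g y) (Y : Plane) :
    fderiv ℝ (fun z => ip ε (f z) (g z)) y Y =
      ip ε (fderiv ℝ f y Y) (g y) + ip ε (f y) (fderiv ℝ g y Y) := by
  have h1 : HasFDerivAt (fun z => ipL ε (f z)) (ipL ε ∘L fderiv ℝ f y) y :=
    (ipL ε).hasFDerivAt.comp y hf.hasFDerivAt
  have h2 := h1.clm_apply hg.hasFDerivAt
  have h3 := congrArg (fun L => L Y) h2.fderiv
  simp only [ipL_apply] at h3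
  rw [h3]
  simp [add_comm]

theorem fderiv_apply_eq_zero_of_eventually_const {f : Plane → ℝ} {y : Plane} {c : ℝ}
    (h : ∀ᶠ z in nhds y, f z = c) (Y : Plane) : fderiv ℝ f y Y = 0 := by
  have h' : f =ᶠ[nhds y] fun _ => c := h
  rw [h'.fderiv_eq]
  simp

theorem tangent_TN_of_contDiffAt {g : Plane → V3 × V3} {y : Plane} (hg : ContDiffAt ℝ ∞ g y)
    (h : ∀ᶠ z in nhds y, g z ∈ (tangentBundleData ε).carrier) (Y : Plane) :
    fderiv ℝ g y Y ∈ tangentTN ε (g y) := by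
  have hd : DifferentiableAt ℝ g y := hg.differentiableAt (by simp)
  have e1 : fderiv ℝ (fun z => (g z).1) y Y = (fderiv ℝ g y Y).1 := by
    rw [fderiv.fst hd]; rfl
  have e2 : fderiv ℝ (fun z => (g z).2) y Y = (fderiv ℝ g y Y).2 := by
    rw [fderiv.snd hd]; rfl
  have h1 := fderiv_ip (ε := ε) hd.fst hd.fst Y
  rw [fderiv_apply_eq_zero_of_eventually_const (h.mono fun z hz => hz.1.1), e1] at h1
  have h2 := fderiv_ip (ε := ε) hd.fst hd.snd Y
  rw [fderiv_apply_eq_zero_of_eventually_const (h.mono fun z hz => hz.2), e1, e2] at h2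
  refine ⟨?_, h2.symm⟩
  rw [ip_comm ε _ (g y).1] at h1
  linarith

theorem differentiableAt_rot {f g : Plane → V3} {y : Plane} (hf : DifferentiableAt ℝ f y)
    (hg : DifferentiableAt ℝ g y) : DifferentiableAt ℝ (fun z => rot ε (f z) (g z)) y := by
  rw [differentiableAt_pi]
  intro i
  fin_cases i
  · simp only [Fin.zero_eta, rot_apply_zero]; fun_prop
  · simp only [Fin.mk_one, rot_apply_one]; fun_prop
  · simp only [Fin.reduceFinMk, rot_apply_two]; fun_prop

/-- Locally, the normal `rot x x'` of a β-surface of `TN` has constant direction `m`, and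
`⟨v, m⟩` is constant. -/
theorem exists_local_conormal_TN (hε : ε = 1 ∨ ε = -1) {g : Plane → V3 × V3} {D : Set Plane}
    (hD : IsOpen D) (hg : ContDiffOn ℝ ∞ g D) (hgM : ∀ y ∈ D, g y ∈ (tangentBundleData ε).carrier)
    (hβ : ∀ y ∈ D, IsBetaPlane (tangentBundleData ε) (g y) (fderiv ℝ g y)) {y₀ : Plane}
    (hy₀ : y₀ ∈ D) :
    ∃ (m : V3) (h : ℝ), m ≠ 0 ∧ ∀ᶠ y in nhds y₀, ip ε (g y).1 m = 0 ∧ ip ε (g y).2 m = h ∧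
      ∀ Y, ip ε (fderiv ℝ g y Y).1 m = 0 := by
  have hε' := mul_self_of_eq hε
  have hgy {y} (hy : y ∈ D) : ContDiffAt ℝ ∞ g y := hg.contDiffAt (hD.mem_nhds hy)
  have hd {y} (hy : y ∈ D) : DifferentiableAt ℝ g y := (hgy hy).differentiableAt (by simp)
  have e1 {y} (hy : y ∈ D) (Y) : fderiv ℝ (fun z => (g z).1) y Y = (fderiv ℝ g y Y).1 := by
    rw [fderiv.fst (hd hy)]; rfl
  have e2 {y} (hy : y ∈ D) (Y) : fderiv ℝ (fun z => (g z).2) y Y = (fderiv ℝ g y Y).2 := by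
    rw [fderiv.snd (hd hy)]; rfl
  have hT {y} (hy : y ∈ D) (Y) : fderiv ℝ g y Y ∈ tangentTN ε (g y) :=
    tangent_TN_of_contDiffAt (hgy hy) (Filter.mem_of_superset (hD.mem_nhds hy) hgM) Y
  have hdir {y} (hy : y ∈ D) := (hβ y hy).exists_direction_TN hε (hgM y hy).1 (hT hy)
  -- The vector `X` is chosen once, at `y₀`. Its horizontal image stays nonzero nearby, which gives
  -- a differentiable choice of direction.
  obtain ⟨X, -, hX, -⟩ := hdir hy₀
  have hdX {y} (hy : y ∈ D) : DifferentiableAt ℝ (fun z => (fderiv ℝ g z X).1) y := by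
    have : DifferentiableAt ℝ (fderiv ℝ g) y :=
      ((hgy hy).fderiv_right (m := 1) (by norm_cast)).differentiableAt (by simp)
    fun_prop
  set ν : Plane → V3 := fun y => rot ε (g y).1 (fderiv ℝ g y X).1
  have hν {y} (hy : y ∈ D) : DifferentiableAt ℝ ν y := differentiableAt_rot (hd hy).fst (hdX hy)
  set n₀ := ν y₀
  have hn₀ : 0 < ip ε n₀ n₀ := by
    rw [ip_rot_rot hε' (hgM y₀ hy₀).1.1 (hT hy₀ X).1]
    exact ip_self_pos hε (hgM y₀ hy₀).1 (hT hy₀ X).1 hX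
  set ℓ : Plane → ℝ := fun y => ip ε n₀ (ν y)
  have hℓ {y} (hy : y ∈ D) : DifferentiableAt ℝ ℓ y :=
    differentiableAt_ip (differentiableAt_const n₀) (hν hy)
  -- The scale is fixed by `⟨n₀, n⟩ = 1`, so that `dn` is orthogonal to `n₀` and cannot have a
  -- component along `ν`.
  set n : Plane → V3 := fun y => (ℓ y)⁻¹ • ν y
  obtain ⟨r, hr, hball⟩ := Metric.mem_nhds_iff.1 (Filter.inter_mem (hD.mem_nhds hy₀)
    (Filter.inter_mem ((hdX hy₀).continuousAt.eventually_ne hX)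
      ((hℓ hy₀).continuousAt.eventually_ne hn₀.ne')))
  have hDy {y} (hy : y ∈ Metric.ball y₀ r) : y ∈ D := (hball hy).1
  have hXy {y} (hy : y ∈ Metric.ball y₀ r) : (fderiv ℝ g y X).1 ≠ 0 := (hball hy).2.1
  have hℓy {y} (hy : y ∈ Metric.ball y₀ r) : ℓ y ≠ 0 := (hball hy).2.2
  have hn {y} (hy : y ∈ Metric.ball y₀ r) : DifferentiableAt ℝ n y :=
    ((hℓ (hDy hy)).inv (hℓy hy)).smul (hν (hDy hy))
  have hnx (y) : ip ε (g y).1 (n y) = 0 := by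
    simp only [n, ν, ip_smul_right, ip_rot_self_left hε', mul_zero]
  have hn1 {y} (hy : y ∈ D) (Y) : ip ε (n y) (fderiv ℝ g y Y).1 = 0 := by
    obtain ⟨-, -, -, -, -, h⟩ := hdir hy
    simp only [n, ν, ip_smul_left, ip_rot ε hε', (h X Y).1, mul_zero]
  have hn2 {y} (hy : y ∈ D) (Y) : ip ε (n y) (fderiv ℝ g y Y).2 = 0 := by
    obtain ⟨-, -, -, -, -, h⟩ := hdir hy
    simp only [n, ν, ip_smul_left, ip_rot ε hε', (h X Y).2, mul_zero]
  have hℓn {y} (hy : y ∈ Metric.ball y₀ r) : ip ε n₀ (n y) = 1 := by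
    simp only [n, ip_smul_right]
    exact inv_mul_cancel₀ (hℓy hy)
  have hdn {y} (hy : y ∈ Metric.ball y₀ r) : fderiv ℝ n y = 0 := by
    have hyD := hDy hy
    have hnhds := Metric.isOpen_ball.mem_nhds hy
    -- The vertical vector `Z` may depend on `y`: it is used only pointwise and never
    -- differentiated.
    obtain ⟨-, Z, -, hZ, hZ', hdet⟩ := hdir hyD
    have hx (Y) : ip ε (g y).1 (fderiv ℝ n y Y) = 0 := by
      have h1 := fderiv_ip (ε := ε) (hd hyD).fst (hn hy) Y
      rw [fderiv_apply_eq_zero_of_eventually_const (.of_forall hnx), e1 hyD,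
        ip_comm ε (fderiv ℝ g y Y).1, hn1 hyD, zero_add] at h1
      exact h1.symm
    have hl (Y) : ip ε n₀ (fderiv ℝ n y Y) = 0 := by
      have h1 := fderiv_ip (ε := ε) (differentiableAt_const n₀) (hn hy) Y
      rw [fderiv_apply_eq_zero_of_eventually_const
        (Filter.mem_of_superset hnhds fun z hz => hℓn hz)] at h1
      simpa [ip_zero_left] using h1.symm
    have hX' (Y) (h : ip ε (fderiv ℝ n y Y) (fderiv ℝ g y X).1 = 0) : fderiv ℝ n y Y = 0 := by
      obtain ⟨k, hk⟩ := eq_smul_rot hε (hgM y hyD).1 (hT hyD X).1 (hXy hy) (hx Y)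
        ((ip_comm _ _ _).trans h)
      have h0 := hl Y
      rw [hk, ip_smul_right] at h0
      rw [hk, (mul_eq_zero.1 h0).resolve_right (hℓy hy), zero_smul]
    refine fderiv_conormal_eq_zero (ipL ε) (F₁ := fun z => (g z).1) (F₂ := fun z => (g z).2)
      (X := X) (Z := Z) (hn hy) (hgy hyD).fst (hgy hyD).snd ?_ ?_ ?_ ?_ ?_
    · filter_upwards [hD.mem_nhds hyD] with z hz Y
      rw [e1 hz, ipL_apply, hn1 hz]
    · filter_upwards [hD.mem_nhds hyD] with z hz Y
      rw [e2 hz, ipL_apply, hn2 hz]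
    · rw [e1 hyD, hZ]
    · intro Y h
      rw [e1 hyD, ipL_apply] at h
      exact hX' Y h
    · intro Y h
      rw [e2 hyD, ipL_apply] at h
      apply hX'
      have hZt : ip ε (g y).1 (fderiv ℝ g y Z).2 = 0 := by
        simpa [hZ, ip_zero_left] using (hT hyD Z).2
      obtain ⟨k, hk⟩ := parallel_of_det3 hε (hgM y hyD).1 (hT hyD X).1 hZt (hXy hy) (hdet X Z).2
      rw [hk, ip_smul_right] at h
      refine (mul_eq_zero.1 h).resolve_left ?_
      rintro rfl
      exact hZ' (by rw [hk, zero_smul])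
  have hcn {y} (hy : y ∈ Metric.ball y₀ r) : n y = n y₀ :=
    Metric.isOpen_ball.is_const_of_fderiv_eq_zero (convex_ball y₀ r).isPreconnected
      (fun z hz => (hn hz).differentiableWithinAt) (fun z hz => hdn hz) hy (Metric.mem_ball_self hr)
  refine ⟨n y₀, ip ε (g y₀).2 (n y₀), ?_,
    Filter.mem_of_superset (Metric.ball_mem_nhds y₀ hr) fun y hy => ⟨?_, ?_, fun Y => ?_⟩⟩
  · intro h
    have := hℓn (Metric.mem_ball_self hr)
    simp [h, ip_zero_right] at this
  · rw [← hcn hy, hnx]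
  -- Once `n` is constant, the derivative of `⟨v, n⟩` is `⟨dv, n⟩`, which vanishes.
  · refine Metric.isOpen_ball.is_const_of_fderiv_eq_zero (𝕜 := ℝ)
      (f := fun y => ip ε (g y).2 (n y₀)) (convex_ball y₀ r).isPreconnected
      (fun z hz => (differentiableAt_ip (hd (hDy hz)).snd
        (differentiableAt_const _)).differentiableWithinAt) (fun z hz => ?_) hy
      (Metric.mem_ball_self hr)
    ext1 Y
    rw [fderiv_ip (hd (hDy hz)).snd (differentiableAt_const _), e2 (hDy hz), ip_comm, ← hcn hz,
      hn2 (hDy hz)]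
    simp [ip_zero_right]
  · rw [ip_comm, ← hcn hy, hn1 (hDy hy)]

end LocalTN

/-! ### Bundles over geodesics and the global statement for `TN` -/

section GlobalTN

variable {ε : ℝ}

/-- The affine tangent bundle over the geodesic `⟨x, m⟩ = 0`, at signed distance `h` from the
zero section. -/
def geodesicBundle (ε : ℝ) (m : V3) (h : ℝ) : Set (V3 × V3) :=
  {p | p ∈ (tangentBundleData ε).carrier ∧ ip ε p.1 m = 0 ∧ ip ε p.2 m = h}

theorem geodesicBundle_smul {m : V3} {h t : ℝ} (ht : t ≠ 0) :
    geodesicBundle ε (t • m) (t * h) = geodesicBundle ε m h := by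
  ext p
  simp only [geodesicBundle, mem_ofPred_eq, ip_smul_right, mul_eq_zero, ht, false_or,
    mul_right_inj' ht]

/-- Circular functions for `ε = 1` and hyperbolic ones for `ε = -1`, so that geodesics of both base
surfaces are parametrised by one formula. The last clause gives surjectivity onto the whole circle
or branch. -/
theorem exists_trig (hε : ε = 1 ∨ ε = -1) : ∃ C S : ℝ → ℝ, ContDiff ℝ ∞ C ∧ ContDiff ℝ ∞ S ∧
    (∀ s, HasDerivAt C (-ε * S s) s) ∧ (∀ s, HasDerivAt S (C s) s) ∧
    (∀ s, C s ^ 2 + ε * S s ^ 2 = 1) ∧ (ε < 0 → ∀ s, 0 < C s) ∧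
    ∀ u w : ℝ, u ^ 2 + ε * w ^ 2 = 1 → (ε < 0 → 0 < u) → ∃ s, u = C s ∧ w = S s := by
  rcases hε with rfl | rfl
  · refine ⟨Real.cos, Real.sin, Real.contDiff_cos, Real.contDiff_sin,
      fun s => by simpa using Real.hasDerivAt_cos s, Real.hasDerivAt_sin,
      fun s => by rw [one_mul]; exact Real.cos_sq_add_sin_sq s, fun h => by norm_num at h,
      fun u w h _ => ?_⟩
    have hn : ‖(⟨u, w⟩ : ℂ)‖ = 1 := by
      rw [Complex.norm_eq_sqrt_sq_add_sq, Real.sqrt_eq_one]; linarith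
    have h0 : (⟨u, w⟩ : ℂ) ≠ 0 := by rw [← norm_ne_zero_iff, hn]; exact one_ne_zero
    exact ⟨Complex.arg ⟨u, w⟩, by rw [Complex.cos_arg h0, hn, div_one],
      by rw [Complex.sin_arg, hn, div_one]⟩
  · refine ⟨Real.cosh, Real.sinh, Real.contDiff_cosh, Real.contDiff_sinh,
      fun s => by simpa using Real.hasDerivAt_cosh s, Real.hasDerivAt_sinh,
      fun s => by linarith [Real.cosh_sq s], fun _ => Real.cosh_pos, fun u w h hu => ?_⟩
    refine ⟨Real.arsinh w, ?_, (Real.sinh_arsinh w).symm⟩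
    have hu : 0 < u := hu (by norm_num)
    have := Real.cosh_sq (Real.arsinh w)
    rw [Real.sinh_arsinh] at this
    exact (sq_eq_sq₀ hu.le (Real.cosh_pos _).le).1 (by linarith)

theorem mem_baseSurface_of_ip (hε : ε = 1 ∨ ε = -1) {x y : V3} (hx : x ∈ baseSurface ε)
    (hy : ip ε y y = ε) (hxy : ε < 0 → 0 < ε * ip ε x y) : y ∈ baseSurface ε := by
  refine ⟨hy, fun h0 => ?_⟩
  have hxy := hxy h0
  obtain rfl : ε = -1 := hε.resolve_left (by rintro rfl; norm_num at h0)
  by_contra! h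
  have hne : y 2 ≠ 0 := by
    intro h2
    simp only [ip, h2] at hy
    nlinarith [sq_nonneg (y 0), sq_nonneg (y 1)]
  -- If `y` lay on the lower sheet, then `-y` would lie on the upper one, and its product with `x`
  -- would have the wrong sign.
  have hm : (-1 : ℝ) • y ∈ baseSurface (-1) :=
    ⟨by simp only [ip_smul_left, ip_smul_right, hy]; norm_num, fun _ => by
      simpa using lt_of_le_of_ne h hne⟩
  have := ip_neg_of_mem hx hm
  rw [ip_smul_right] at this
  linarith

/-- Orthogonal expansion in the plane orthogonal to a unit normal. -/
theorem eq_add_of_ip (hε : ε = 1 ∨ ε = -1) {x a y : V3} (hx : x ∈ baseSurface ε)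
    (ha : ip ε x a = 0) (ha1 : ip ε a a = 1) (hy : ip ε y (rot ε x a) = 0) :
    y = (ε * ip ε y x) • x + ip ε y a • a := by
  have hε' := mul_self_of_eq hε
  rw [← sub_eq_zero]
  refine eq_zero_of_ip_eq_zero hε' (a := x) (b := a) (c := rot ε x a) ?_ ?_ ?_ ?_
  · rw [← ip_rot ε hε', ip_rot_rot hε' hx.1 ha, ha1]; exact one_ne_zero
  · rw [ip_sub_left, ip_add_left, ip_smul_left, ip_smul_left, ip_comm ε a x, ha, hx.1]
    linear_combination -ip ε y x * hε'
  · rw [ip_sub_left, ip_add_left, ip_smul_left, ip_smul_left, ha, ha1]; ring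
  · rw [ip_sub_left, ip_add_left, ip_smul_left, ip_smul_left, hy, ip_rot_self_left hε',
      ip_rot_self_right hε']; ring

theorem geodesicBundle_isAffineTangentBundle (hε : ε = 1 ∨ ε = -1) {x m : V3} {h : ℝ}
    (hx : x ∈ baseSurface ε) (hm : ip ε x m = 0) (hm1 : ip ε m m = 1) :
    ∃ c, HasConstGeodesicCurvature ε c ∧ IsAffineTangentBundle ε c (geodesicBundle ε m h) := by
  have hε' := mul_self_of_eq hε
  obtain ⟨C, S, hCd, hSd, hC, hS, hCS, hCpos, hex⟩ := exists_trig hε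
  -- The sign is chosen so that `rot ε x a = m`: the geodesic starts at `x` in direction `a` and has
  -- normal `m`.
  set a : V3 := -rot ε x m with ha_def
  have ha_smul : a = (-1 : ℝ) • rot ε x m := by rw [ha_def, neg_one_smul]
  have ha : ip ε x a = 0 := by rw [ha_smul, ip_smul_right, ip_rot_self_left hε', mul_zero]
  have ham : ip ε a m = 0 := by
    rw [ha_smul, ip_smul_left, ip_comm, ip_rot_self_right hε', mul_zero]
  have ha1 : ip ε a a = 1 := by
    rw [ha_smul, ip_smul_left, ip_smul_right, ip_rot_rot hε' hx.1 hm, hm1]; norm_num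
  have hxa : rot ε x a = m := by
    rw [ha_smul, rot_smul, rot_rot hε' hx.1 hm]; simp
  have hax : ip ε a x = 0 := by rw [ip_comm, ha]
  set c : ℝ → V3 := fun s => C s • x + S s • a
  set T : ℝ → V3 := fun s => (-ε * S s) • x + C s • a
  have hcd (s) : HasDerivAt c (T s) s := ((hC s).smul_const x).add ((hS s).smul_const a)
  have hTd (s) : HasDerivAt T (-ε • c s) s := by
    refine ((((hS s).const_mul (-ε)).smul_const x).add ((hC s).smul_const a)).congr_deriv ?_
    simp only [c, smul_add, smul_smul]
  have hdc : deriv c = T := funext fun s => (hcd s).deriv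
  have hdT : deriv T = fun s => -ε • c s := funext fun s => (hTd s).deriv
  have hcc (s) : ip ε (c s) (c s) = ε := by
    simp only [c, ip_add_left, ip_add_right, ip_smul_left, ip_smul_right, ha, hax, ha1, hx.1]
    linear_combination ε * hCS s - (S s ^ 2) * hε'
  have hcT (s) : ip ε (c s) (T s) = 0 := by
    simp only [c, T, ip_add_left, ip_add_right, ip_smul_left, ip_smul_right, ha, hax, ha1, hx.1]
    linear_combination (-C s * S s) * hε'
  have hTT (s) : ip ε (T s) (T s) = 1 := by
    simp only [T, ip_add_left, ip_add_right, ip_smul_left, ip_smul_right, ha, hax, ha1, hx.1]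
    linear_combination hCS s + (ε * S s ^ 2) * hε'
  have hcm (s) : ip ε (c s) m = 0 := by
    simp only [c, ip_add_left, ip_smul_left, hm, ham]; ring
  have hTm (s) : ip ε (T s) m = 0 := by
    simp only [T, ip_add_left, ip_smul_left, hm, ham]; ring
  have hcN (s) : c s ∈ baseSurface ε := by
    refine mem_baseSurface_of_ip hε hx (hcc s) fun h0 => ?_
    have : ε * ip ε x (c s) = C s := by
      simp only [c, ip_add_right, ip_smul_right, ha, hx.1]
      linear_combination C s * hε'
    rw [this]
    exact hCpos h0 s
  have hcsmooth : ContDiff ℝ ∞ c := (hCd.smul contDiff_const).add (hSd.smul contDiff_const)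
  -- The acceleration `c'' = -ε c` is normal to the base surface, so the curvature constant is `0`.
  -- The constant field `h • m` serves as base point of each fibre.
  refine ⟨c, ⟨hcsmooth, hcN, fun s => by rw [hdc, hTT], 0, fun s => ?_⟩,
    fun _ => h • m, contDiff_const, fun s => by rw [ip_smul_right, hcm, mul_zero],
    fun s s' _ => ⟨0, by simp⟩, ?_⟩
  · rw [hdc, hdT, ip_smul_left, ip_rot_self_left hε', mul_zero]
  · rw [hdc]
    ext ⟨y, v⟩
    constructor
    · rintro ⟨⟨hy, hyv⟩, hym, hvm⟩
      simp only at hy hyv hym hvm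
      have hyx := eq_add_of_ip hε hx ha ha1 (hxa ▸ hym)
      -- The coordinates of `y` in the basis `x`, `a` satisfy `u² + ε w² = 1`, hence are of the form
      -- `(C s, S s)`.
      obtain ⟨s, hs, hs'⟩ := hex (ε * ip ε y x) (ip ε y a) (by
        have h1 : ip ε y y = ε * (ip ε y x) ^ 2 + ip ε y a ^ 2 := by
          conv_lhs => rw [hyx]
          simp only [ip_add_left, ip_add_right, ip_smul_left, ip_smul_right, ha, hax, ha1, hx.1]
          linear_combination (ε * (ip ε y x) ^ 2) * hε'
        rw [hy.1] at h1
        linear_combination -ε * h1 + hε') (fun h0 => by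
        obtain rfl : ε = -1 := hε.resolve_left (by rintro rfl; norm_num at h0)
        linarith [ip_neg_of_mem hy hx])
      rw [hs, hs'] at hyx
      have hyc : y = c s := hyx
      subst hyc
      have hT0 : T s ≠ 0 := by
        intro h0
        have := hTT s
        simp [h0, ip_zero_left] at this
      obtain ⟨k, hk⟩ := eq_smul_rot hε (hcN s) (hcT s) hT0 (hcm s) (hTm s)
      have hk0 : k ≠ 0 := by
        rintro rfl
        rw [hk, zero_smul, ip_zero_left] at hm1
        exact zero_ne_one hm1
      -- The normal `m` is a multiple of `rot ε (c s) (T s)`, so a tangent vector orthogonal to `m`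
      -- is parallel to `T s`.
      have hdet : det3 (c s) (T s) (v - h • m) = 0 := by
        have h1 : ip ε m (v - h • m) = 0 := by
          rw [ip_sub_right, ip_smul_right, hm1, ip_comm, hvm]; ring
        rw [hk, ip_smul_left, ip_rot ε hε', ← hk] at h1
        exact (mul_eq_zero.1 h1).resolve_left hk0
      obtain ⟨t, ht⟩ := parallel_of_det3 hε (hcN s) (hcT s) (u := v - h • m)
        (by rw [ip_sub_right, hyv, ip_smul_right, hcm]; ring) hT0 hdet
      exact ⟨s, t, Prod.ext rfl (by rw [← ht]; simp)⟩
    · rintro ⟨s, t, hst⟩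
      obtain ⟨rfl, rfl⟩ := Prod.mk.inj hst
      refine ⟨⟨hcN s, ?_⟩, hcm s, ?_⟩
      · simp only [ip_add_right, ip_smul_right, hcm, hcT]; ring
      · simp only [ip_add_left, ip_smul_left, hm1, hTm]; ring

/-- Near a point over `x`, the geodesic bundle has the coordinates `⟨·, a⟩`, `a` the direction of
the geodesic at `x`. -/
theorem geodesicBundle_inj (hε : ε = 1 ∨ ε = -1) {x a m : V3} {h : ℝ} (hx : x ∈ baseSurface ε)
    (ha : ip ε x a = 0) (ha0 : a ≠ 0) (hm0 : m ≠ 0) (hxm : ip ε x m = 0) (ham : ip ε a m = 0)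
    {p q : V3 × V3} (hp : p ∈ geodesicBundle ε m h) (hq : q ∈ geodesicBundle ε m h)
    (hpx : 0 < ε * ip ε p.1 x) (hqx : 0 < ε * ip ε q.1 x)
    (h1 : ip ε p.1 a = ip ε q.1 a) (h2 : ip ε p.2 a = ip ε q.2 a) : p = q := by
  have hε' := mul_self_of_eq hε
  obtain ⟨k, hk⟩ := eq_smul_rot hε hx ha ha0 hxm ham
  have hk0 : k ≠ 0 := by rintro rfl; exact hm0 (by rw [hk, zero_smul])
  have hdet : det3 x a m ≠ 0 := by
    rw [hk, det3_smul_right, ← ip_rot ε hε', ip_rot_rot hε' hx.1 ha]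
    exact mul_ne_zero hk0 (ip_self_pos hε hx ha ha0).ne'
  have key {r : V3} (hra : ip ε r a = 0) (hrm : ip ε r m = 0) : r = (ε * ip ε r x) • x := by
    rw [← sub_eq_zero]
    refine eq_zero_of_ip_eq_zero hε' hdet ?_ ?_ ?_
    · rw [ip_sub_left, ip_smul_left, hx.1]; linear_combination -ip ε r x * hε'
    · rw [ip_sub_left, ip_smul_left, ha, hra]; ring
    · rw [ip_sub_left, ip_smul_left, hxm, hrm]; ring
  obtain ⟨⟨hp1, hp2⟩, hpm, hpm'⟩ := hp
  obtain ⟨⟨hq1, hq2⟩, hqm, hqm'⟩ := hq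
  have e1 : p.1 = q.1 := by
    have hr := key (r := p.1 - q.1) (by rw [ip_sub_left, h1, sub_self])
      (by rw [ip_sub_left, hpm, hqm, sub_self])
    set τ := ε * ip ε (p.1 - q.1) x
    -- The difference of base points is a multiple `τ x`. Both have the same square, so `τ ⟨x, p.1 +
    -- q.1⟩ = 0`, and the half-space condition excludes the second factor.
    have h3 : ip ε (p.1 - q.1) (p.1 + q.1) = 0 := by
      rw [ip_sub_left, ip_add_right, ip_add_right, hp1.1, hq1.1, ip_comm ε q.1 p.1]; ring
    rw [hr, ip_smul_left, ip_add_right, ip_comm ε x, ip_comm ε x] at h3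
    have hτ : τ = 0 := by
      refine (mul_eq_zero.1 h3).resolve_right fun h4 => ?_
      have : ε * (ip ε p.1 x + ip ε q.1 x) = 0 := by rw [h4, mul_zero]
      linarith
    rw [hτ, zero_smul] at hr
    exact sub_eq_zero.1 hr
  refine Prod.ext e1 ?_
  have hr := key (r := p.2 - q.2) (by rw [ip_sub_left, h2, sub_self])
    (by rw [ip_sub_left, hpm', hqm', sub_self])
  set τ := ε * ip ε (p.2 - q.2) x
  have h3 : ip ε p.1 (p.2 - q.2) = 0 := by
    rw [ip_sub_right, hp2, e1, hq2, sub_self]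
  rw [hr, ip_smul_right] at h3
  have hτ : τ = 0 := (mul_eq_zero.1 h3).resolve_right fun h4 => by simp [h4] at hpx
  rw [hτ, zero_smul] at hr
  exact sub_eq_zero.1 hr

variable {S : Type*} [TopologicalSpace S] [ChartedSpace (EuclideanSpace ℝ (Fin 2)) S]
  [IsManifold (𝓡 2) ∞ S] [ConnectedSpace S]

/-- The local constants `(m, h)` are unique only up to a common factor, but they cut out the same
`geodesicBundle`, so the bundle is globally well defined. The pairings with a horizontal direction
`a` at the point are the coordinates that make the image open in it. -/
theorem betaSurface_TN (hε : ε = 1 ∨ ε = -1) {f : S → V3 × V3}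
    (hf : IsBetaSurface (tangentBundleData ε) f) :
    ∃ c B, HasConstGeodesicCurvature ε c ∧ IsAffineTangentBundle ε c B ∧
      IsPieceOf (range f) B := by
  have hε' := mul_self_of_eq hε
  have hT (p) (X : TangentSpace (𝓡 2) p) :
      mfderiv (𝓡 2) 𝓘(ℝ, V3 × V3) f p X ∈ tangentTN ε (f p) := by
    refine (eventually_of_chart (Q := fun w ξ => ξ ∈ tangentTN ε w) hf.2.1 p ?_).self_of_nhds X
    filter_upwards [extChartAt_target_mem_nhds (I := 𝓡 2) p] with y hy
    exact tangent_TN_of_contDiffAt ((contDiffOn_comp_chart_symm hf.2.1 p).contDiffAt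
      ((isOpen_extChartAt_target p).mem_nhds hy)) (.of_forall fun z => hf.1 _)
  have hdir (p) := IsBetaPlane.exists_direction_TN hε (hf.1 p).1
    (L := mfderiv (𝓡 2) 𝓘(ℝ, V3 × V3) f p) ⟨hf.2.2.1 p, hf.2.2.2 p⟩ (hT p)
  -- The last condition makes `a.1` orthogonal to the horizontal tangent direction as well, which
  -- determines it up to scale.
  let R (p : S) (a : V3 × ℝ) : Prop := a.1 ≠ 0 ∧ ip ε (f p).1 a.1 = 0 ∧ ip ε (f p).2 a.1 = a.2 ∧
    ∀ X : TangentSpace (𝓡 2) p, ip ε (mfderiv (𝓡 2) 𝓘(ℝ, V3 × V3) f p X).1 a.1 = 0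
  obtain ⟨⟨m, h⟩, ⟨p₀, hp₀⟩, hall⟩ := exists_global_parameter (R := R)
    (B := fun a => geodesicBundle ε a.1 a.2) (fun p a b hRa hRb => by
      obtain ⟨X, -, hX, -⟩ := hdir p
      obtain ⟨k, hk⟩ := eq_smul_rot hε (hf.1 p).1 (hT p X).1 hX hRa.2.1 (hRa.2.2.2 X)
      obtain ⟨l, hl⟩ := eq_smul_rot hε (hf.1 p).1 (hT p X).1 hX hRb.2.1 (hRb.2.2.2 X)
      have hk0 : k ≠ 0 := by rintro rfl; exact hRa.1 (by rw [hk, zero_smul])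
      have hl0 : l ≠ 0 := by rintro rfl; exact hRb.1 (by rw [hl, zero_smul])
      simp only [← hRa.2.2.1, ← hRb.2.2.1]
      rw [hk, hl, ip_smul_right, ip_smul_right, geodesicBundle_smul hk0,
        geodesicBundle_smul hl0]) (fun p => by
      obtain ⟨m, h, hm, hev⟩ := exists_local_conormal_TN hε
        (isOpen_extChartAt_target (I := 𝓡 2) p) (contDiffOn_comp_chart_symm hf.2.1 p)
        (fun y _ => hf.1 _) (fun y hy => hf.isBetaPlane_chart p hy)
        (mem_extChartAt_target (I := 𝓡 2) p)
      refine ⟨(m, h), ?_⟩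
      have := eventually_of_chart (Q := fun w ξ => ip ε w.1 m = 0 ∧ ip ε w.2 m = h ∧
        ip ε ξ.1 m = 0) hf.2.1 p (hev.mono fun y hy X => ⟨hy.1, hy.2.1, hy.2.2 X⟩)
      filter_upwards [this] with q hq
      exact ⟨hm, (hq 0).1, (hq 0).2.1, fun X => (hq X).2.2⟩)
  have hB (p) : f p ∈ geodesicBundle ε m h := by
    obtain ⟨b, hb, hbB⟩ := hall p
    exact hbB ▸ ⟨hf.1 p, hb.2.1, hb.2.2.1⟩
  have hmm := ip_self_pos hε (hf.1 p₀).1 hp₀.2.1 hp₀.1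
  obtain ⟨c, hc, hcB⟩ := geodesicBundle_isAffineTangentBundle hε (hf.1 p₀).1
    (m := (√(ip ε m m))⁻¹ • m) (h := (√(ip ε m m))⁻¹ * h)
    (by rw [ip_smul_right, hp₀.2.1, mul_zero])
    (by rw [ip_smul_left, ip_smul_right, ← mul_assoc, ← mul_inv, Real.mul_self_sqrt hmm.le,
      inv_mul_cancel₀ hmm.ne'])
  rw [geodesicBundle_smul (inv_ne_zero (Real.sqrt_pos.2 hmm).ne')] at hcB
  refine ⟨c, _, hc, hcB, isPieceOf_range hf.2.1 hB fun p => ?_⟩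
  obtain ⟨X, -, hX, -, -, hdet⟩ := hdir p
  obtain ⟨b, hb, hbB⟩ := hall p
  set a := (mfderiv (𝓡 2) 𝓘(ℝ, V3 × V3) f p X).1
  have ha : ip ε (f p).1 a = 0 := (hT p X).1
  have haa := ip_self_pos hε (hf.1 p).1 ha hX
  refine ⟨((ipL ε a).comp (ContinuousLinearMap.fst ℝ V3 V3)).prod
    ((ipL ε a).comp (ContinuousLinearMap.snd ℝ V3 V3)),
    ⟨{q | 0 < ε * ip ε q.1 (f p).1}, ?_, ?_⟩, ?_⟩
  · refine IsOpen.mem_nhds ?_ ?_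
    · refine isOpen_lt continuous_const ?_
      simp only [ip]
      fun_prop
    · simp only [mem_ofPred_eq, (hf.1 p).1.1, hε', zero_lt_one]
  · rintro q ⟨hq, hq'⟩ q' ⟨hr, hr'⟩ hqq
    obtain ⟨e1, e2⟩ := Prod.mk.inj hqq
    have e1 : ip ε a q.1 = ip ε a q'.1 := e1
    have e2 : ip ε a q.2 = ip ε a q'.2 := e2
    rw [ip_comm ε a, ip_comm ε a] at e1 e2
    rw [← hbB] at hq hr
    exact geodesicBundle_inj hε (hf.1 p).1 ha hX hb.1 hb.2.1 (hb.2.2.2 X) hq hr hq' hr' e1 e2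
  · intro Y hY
    obtain ⟨e1, e2⟩ := Prod.mk.inj hY
    have e1 : ip ε a (mfderiv (𝓡 2) 𝓘(ℝ, V3 × V3) f p Y).1 = 0 := e1
    have e2 : ip ε a (mfderiv (𝓡 2) 𝓘(ℝ, V3 × V3) f p Y).2 = 0 := e2
    -- Both components of a tangent vector in the kernel of the coordinates are parallel and
    -- orthogonal to `a`; the second is tangent to the base only once the first is known to vanish.
    have key {u : V3} (h1 : ip ε (f p).1 u = 0) (h2 : det3 (f p).1 a u = 0)
        (h3 : ip ε a u = 0) : u = 0 := by
      obtain ⟨k, hk⟩ := parallel_of_det3 hε (hf.1 p).1 ha h1 hX h2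
      rw [hk, ip_smul_right] at h3
      rw [hk, (mul_eq_zero.1 h3).resolve_right haa.ne', zero_smul]
    have z1 := key (hT p Y).1 (hdet X Y).1 e1
    have z2 := key (by
      have h2 := (hT p Y).2
      rw [z1, ip_zero_left, zero_add] at h2
      exact h2) (hdet X Y).2 e2
    exact hf.2.2.1 p ((Prod.ext z1 z2).trans (map_zero (mfderiv (𝓡 2) 𝓘(ℝ, V3 × V3) f p)).symm)

end GlobalTN

/-! ### Vector algebra for `𝕃(H³)` -/

theorem dotProduct_eq_ip (a b : V3) : a ⬝ᵥ b = ip 1 a b := by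
  simp [dotProduct, Fin.sum_univ_three, ip]

theorem cross_eq_rot (a b : V3) : a ⨯₃ b = rot 1 a b := by
  refine V3.ext ?_ ?_ ?_ <;> simp [rot]

theorem det3_eq_ip_rot (a b c : V3) : det3 a b c = ip 1 a (rot 1 b c) := by
  rw [det3, dotProduct_eq_ip, cross_eq_rot]

theorem rot_swap (a b : V3) : rot 1 a b = -rot 1 b a := by
  refine V3.ext ?_ ?_ ?_ <;>
    simp only [rot_apply_zero, rot_apply_one, rot_apply_two, Pi.neg_apply] <;> ring

theorem rot_rot_eq (x a w : V3) :
    rot 1 x (rot 1 a w) = ip 1 x w • a - ip 1 x a • w := by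
  refine V3.ext ?_ ?_ ?_ <;>
    simp only [rot_apply_zero, rot_apply_one, rot_apply_two, Pi.sub_apply, Pi.smul_apply, ip,
      smul_eq_mul] <;> ring

theorem ip_neg_right (ε : ℝ) (a b : V3) : ip ε a (-b) = -ip ε a b := by simp [ip]; ring

theorem ip_neg_left (ε : ℝ) (a b : V3) : ip ε (-a) b = -ip ε a b := by simp [ip]; ring

theorem ip_one_self_pos {a : V3} (ha : a ≠ 0) : 0 < ip 1 a a := by
  by_contra! h
  simp only [ip] at h
  apply ha
  refine V3.ext ?_ ?_ ?_ <;> simp only [Pi.zero_apply] <;>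
    nlinarith [sq_nonneg (a 0), sq_nonneg (a 1), sq_nonneg (a 2)]

/-- In `ℝ³` the vectors orthogonal to two independent vectors are multiples of their cross
product. -/
theorem eq_smul_cross {p q u : V3} (h : rot 1 p q ≠ 0) (hp : ip 1 u p = 0) (hq : ip 1 u q = 0) :
    ∃ k : ℝ, u = k • rot 1 p q := by
  have hw := ip_one_self_pos h
  refine ⟨ip 1 u (rot 1 p q) / ip 1 (rot 1 p q) (rot 1 p q), sub_eq_zero.1 ?_⟩
  refine eq_zero_of_ip_eq_zero (ε := 1) (by norm_num) (a := p) (b := q) (c := rot 1 p q) ?_ ?_ ?_ ?_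
  · rw [← ip_rot 1 (by norm_num)]; exact hw.ne'
  · rw [ip_sub_left, ip_smul_left, hp, ip_comm 1 _ p, ip_rot_self_left (by norm_num)]; ring
  · rw [ip_sub_left, ip_smul_left, hq, ip_comm 1 _ q, ip_rot_self_right (by norm_num)]; ring
  · rw [ip_sub_left, ip_smul_left, div_mul_cancel₀ _ hw.ne', sub_self]

theorem mem_baseSurface_one {x : V3} (hx : x ∈ sphere2) : x ∈ baseSurface 1 :=
  ⟨(dotProduct_eq_ip x x).symm.trans hx, fun h => by norm_num at h⟩

/-- Twice this number is `|x + y|²`, and `x`, `y` are not antipodal. -/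
theorem one_add_ip_pos {p : V3 × V3} (hp : p ∈ geodesicsH3.carrier) : 0 < 1 + ip 1 p.1 p.2 := by
  obtain ⟨hx, hy, hne⟩ := hp
  have hx := (mem_baseSurface_one hx).1
  have hy := (mem_baseSurface_one hy).1
  have h : p.1 + p.2 ≠ 0 := fun h => hne (eq_neg_of_add_eq_zero_left h)
  have := ip_one_self_pos h
  rw [ip_add_left, ip_add_right, ip_add_right, hx, hy, ip_comm 1 p.2] at this
  linarith

/-- Splitting `a` and `x` into parts along `y` and orthogonal to `y` gives `key`, since three
vectors orthogonal to `y` have zero determinant. In this form, vanishing of `mixed` means that `a`,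
`x + y`, `b` are coplanar. -/
theorem mixed_eq {x y a b : V3} (hy : ip 1 y y = 1) (hb : ip 1 y b = 0)
    (h : 1 + ip 1 x y ≠ 0) :
    mixed x y a b = det3 a (x + y) b / (1 + ip 1 x y) ^ 2 := by
  have key : det3 a x b =
      ip 1 a y * det3 y x b + ip 1 x y * det3 a y b := by
    simp only [ip] at hy hb
    simp only [ip, det3_eq]
    linear_combination -(a 0 * (x 1 * b 2 - x 2 * b 1) + a 1 * (x 2 * b 0 - x 0 * b 2) +
      a 2 * (x 0 * b 1 - x 1 * b 0)) * hy + (a 0 * (x 1 * y 2 - x 2 * y 1) +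
      a 1 * (x 2 * y 0 - x 0 * y 2) + a 2 * (x 0 * y 1 - x 1 * y 0)) * hb
  have h2 : det3 y a b = -det3 a y b := by simp only [det3_eq]; ring
  rw [mixed, dotProduct_eq_ip, dotProduct_eq_ip, det3_add_mid, key, h2]
  field_simp
  ring

theorem mixed_add_left (x y a a' b : V3) :
    mixed x y (a + a') b = mixed x y a b + mixed x y a' b := by
  simp only [mixed, dotProduct_eq_ip, ip_add_left, det3_add_mid]; ring

theorem mixed_smul_left (x y : V3) (r : ℝ) (a b : V3) :
    mixed x y (r • a) b = r • mixed x y a b := by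
  simp only [mixed, dotProduct_eq_ip, ip_smul_left, det3_smul_mid, smul_eq_mul]; ring

theorem mixed_add_right (x y a b b' : V3) :
    mixed x y a (b + b') = mixed x y a b + mixed x y a b' := by
  simp only [mixed, det3_add_right]; ring

theorem mixed_smul_right (x y : V3) (r : ℝ) (a b : V3) :
    mixed x y a (r • b) = r • mixed x y a b := by
  simp only [mixed, det3_smul_right, smul_eq_mul]; ring

theorem mixed_neg_right (x y a b : V3) : mixed x y a (-b) = -mixed x y a b := by
  rw [← neg_one_smul ℝ b, mixed_smul_right, neg_one_smul]

/-- `mixed x y` as a bilinear form. -/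
def mixedL (x y : V3) : V3 →ₗ[ℝ] V3 →ₗ[ℝ] ℝ :=
  LinearMap.mk₂ ℝ (mixed x y) (mixed_add_left x y) (mixed_smul_left x y) (mixed_add_right x y)
    (mixed_smul_right x y)

/-! ### β-planes of `𝕃(H³)` -/

/-- The tangent vector of `S²` at `y` dual to the unit tangent vector `a` at `x` with respect to
`mixed x y`. -/
def dualVec (x y a : V3) : V3 :=
  ip 1 y (rot 1 x a) • (x + y) - (1 + ip 1 x y) • rot 1 x a

/-- A unitary frame of `𝕃(H³)` at `p`. -/
def frameH3 (p : V3 × V3) (a : V3) : Fin 4 → V3 × V3 :=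
  ![(a, dualVec p.1 p.2 a), (rot 1 p.1 a, rot 1 p.2 (dualVec p.1 p.2 a)),
    (a, -dualVec p.1 p.2 a), (rot 1 p.1 a, -rot 1 p.2 (dualVec p.1 p.2 a))]

section Frame

variable {x y a : V3}

theorem ip_dualVec (hy : ip 1 y y = 1) : ip 1 y (dualVec x y a) = 0 := by
  simp only [dualVec, ip_sub_right, ip_smul_right, ip_add_right, hy, ip_comm 1 y x]; ring

theorem rot_rot_right (hx : ip 1 x a = 0) (ha : ip 1 a a = 1) : rot 1 (rot 1 x a) a = -x := by
  rw [rot_swap, rot_swap x a, ← neg_one_smul ℝ (rot 1 a x), rot_smul,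
    rot_rot (by norm_num) ha ((ip_comm _ _ _).trans hx)]
  simp

theorem ip_self_eq_sum (hx : ip 1 x x = 1) (hxa : ip 1 x a = 0) (ha : ip 1 a a = 1) (y : V3) :
    ip 1 y y = ip 1 y x ^ 2 + ip 1 y a ^ 2 + ip 1 y (rot 1 x a) ^ 2 := by
  have hcc : ip 1 (rot 1 x a) (rot 1 x a) = 1 := by rw [ip_rot_rot (by norm_num) hx hxa, ha]
  have hxc : ip 1 x (rot 1 x a) = 0 := ip_rot_self_left (by norm_num) x a
  have hac : ip 1 a (rot 1 x a) = 0 := ip_rot_self_right (by norm_num) x a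
  have hax := (ip_comm 1 a x).trans hxa
  have hcx := (ip_comm 1 (rot 1 x a) x).trans hxc
  have hca := (ip_comm 1 (rot 1 x a) a).trans hac
  have hexp : y - (ip 1 y x • x + ip 1 y a • a + ip 1 y (rot 1 x a) • rot 1 x a) = 0 := by
    refine eq_zero_of_ip_eq_zero (ε := 1) (by norm_num) (a := x) (b := a) (c := rot 1 x a)
      ?_ ?_ ?_ ?_
    · rw [← ip_rot 1 (by norm_num), hcc]; exact one_ne_zero
    all_goals
      simp only [ip_sub_left, ip_add_left, ip_smul_left, hcc, hxc, hac, hax, hcx, hca, hxa, ha, hx]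
      ring
  conv_lhs => rw [sub_eq_zero.1 hexp]
  simp only [ip_add_left, ip_smul_left, ip_add_right, ip_smul_right, hcc, hxc, hac, hax, hcx, hca,
    hxa, ha, hx]
  ring

/-- The identity is tested against the orthonormal basis `x`, `a`, `rot 1 x a`. The component along
`a` is where `|y|² = 1`, expanded in that basis, enters. -/
theorem rot_dualVec (hx : ip 1 x x = 1) (hy : ip 1 y y = 1) (hxa : ip 1 x a = 0)
    (ha : ip 1 a a = 1) :
    rot 1 y (dualVec x y a) = (1 + ip 1 x y) • a - ip 1 y a • (x + y) := by
  have hcc : ip 1 (rot 1 x a) (rot 1 x a) = 1 := by rw [ip_rot_rot (by norm_num) hx hxa, ha]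
  have hxc : ip 1 x (rot 1 x a) = 0 := ip_rot_self_left (by norm_num) x a
  have hac : ip 1 a (rot 1 x a) = 0 := ip_rot_self_right (by norm_num) x a
  have hca : rot 1 (rot 1 x a) a = -x := rot_rot_right hxa ha
  have hxc' : rot 1 x (rot 1 x a) = -a := rot_rot (by norm_num) hx hxa
  have hcx' : rot 1 (rot 1 x a) x = a := by rw [rot_swap, hxc', neg_neg]
  have hsum := ip_self_eq_sum hx hxa ha y
  have hself (u : V3) : rot 1 u u = 0 := by
    refine V3.ext ?_ ?_ ?_ <;> simp only [rot_apply_zero, rot_apply_one, rot_apply_two,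
      Pi.zero_apply] <;> ring
  have hdet (u : V3) : ip 1 (rot 1 y (dualVec x y a)) u =
      ip 1 y (rot 1 x a) * ip 1 y (rot 1 x u) -
        (1 + ip 1 x y) * ip 1 y (rot 1 (rot 1 x a) u) := by
    rw [ip_rot 1 (by norm_num), ← det3_eq_ip_rot y x u, ← det3_eq_ip_rot y (rot 1 x a) u, dualVec]
    simp only [det3_eq, Pi.sub_apply, Pi.smul_apply, Pi.add_apply, smul_eq_mul]
    ring
  rw [← sub_eq_zero]
  refine eq_zero_of_ip_eq_zero (ε := 1) (by norm_num) (a := x) (b := a) (c := rot 1 x a) ?_ ?_ ?_ ?_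
  · rw [← ip_rot 1 (by norm_num), hcc]; exact one_ne_zero
  · rw [ip_sub_left, hdet, hself, hcx', ip_sub_left, ip_smul_left, ip_smul_left, ip_add_left,
      ip_comm 1 a x, hxa, hx, ip_comm 1 y x, ip_zero_right]
    ring
  · rw [ip_sub_left, hdet, hca, ip_sub_left, ip_smul_left, ip_smul_left, ip_add_left, hxa, ha,
      ip_neg_right, ip_comm 1 y x]
    rw [hy, ip_comm 1 y x] at hsum
    linear_combination -hsum
  · rw [ip_sub_left, hdet, hxc', hself, ip_sub_left, ip_smul_left, ip_smul_left, ip_add_left, hac,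
      hxc, ip_neg_right, ip_zero_right]
    ring

theorem det3_dualVec (hxa : ip 1 x a = 0) (hx : ip 1 x x = 1) (ha : ip 1 a a = 1) :
    det3 a (x + y) (dualVec x y a) = (1 + ip 1 x y) ^ 2 ∧
    det3 (rot 1 x a) (x + y) (dualVec x y a) = 0 := by
  have hdet : det3 a (x + y) (rot 1 x a) = -(1 + ip 1 x y) := by
    have h1 : det3 a (x + y) (rot 1 x a) = ip 1 (x + y) (rot 1 (rot 1 x a) a) := by
      rw [← det3_eq_ip_rot]; simp only [det3_eq]; ring
    rw [h1, rot_rot_right hxa ha, ip_neg_right, ip_add_left, hx, ip_comm 1 y]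
  have h2 (u : V3) : det3 u (x + y) (dualVec x y a) =
      -(1 + ip 1 x y) * det3 u (x + y) (rot 1 x a) := by
    simp only [dualVec, det3_eq, Pi.sub_apply, Pi.smul_apply, Pi.add_apply, smul_eq_mul]
    ring
  refine ⟨by rw [h2, hdet]; ring, ?_⟩
  rw [h2]
  simp only [det3_eq]; ring

/-- With `b = dualVec x y a`, the matrix of `mixed` in the bases `(a, j a)` and `(b, j b)` is the
identity. Hence `(a, ±b)` and their images under `j` form a unitary frame. -/
theorem mixed_dualVec (hx : ip 1 x x = 1) (hy : ip 1 y y = 1) (hxy : 1 + ip 1 x y ≠ 0)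
    (hxa : ip 1 x a = 0) (ha : ip 1 a a = 1) :
    mixed x y a (dualVec x y a) = 1 ∧ mixed x y (rot 1 x a) (dualVec x y a) = 0 ∧
    mixed x y a (rot 1 y (dualVec x y a)) = 0 ∧
    mixed x y (rot 1 x a) (rot 1 y (dualVec x y a)) = 1 := by
  obtain ⟨d1, d2⟩ := det3_dualVec (y := y) hxa hx ha
  have hb := ip_dualVec (x := x) (a := a) hy
  have hb' : ip 1 y (rot 1 y (dualVec x y a)) = 0 := ip_rot_self_left (by norm_num) _ _
  have h2 (u : V3) : det3 u (x + y) ((1 + ip 1 x y) • a - ip 1 y a • (x + y)) =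
      (1 + ip 1 x y) * det3 u (x + y) a := by
    simp only [det3_eq, Pi.sub_apply, Pi.smul_apply, Pi.add_apply, smul_eq_mul]
    ring
  have h3 : det3 (rot 1 x a) (x + y) a = 1 + ip 1 x y := by
    have h1 : det3 (rot 1 x a) (x + y) a = -ip 1 (x + y) (rot 1 (rot 1 x a) a) := by
      rw [← det3_eq_ip_rot]; simp only [det3_eq]; ring
    rw [h1, rot_rot_right hxa ha, ip_neg_right, ip_add_left, hx, ip_comm 1 y, neg_neg]
  refine ⟨?_, ?_, ?_, ?_⟩
  · rw [mixed_eq hy hb hxy, d1, div_self (pow_ne_zero 2 hxy)]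
  · rw [mixed_eq hy hb hxy, d2, zero_div]
  · rw [mixed_eq hy hb' hxy, rot_dualVec hx hy hxa ha, h2]
    have : det3 a (x + y) a = 0 := by simp only [det3_eq]; ring
    rw [this, mul_zero, zero_div]
  · rw [mixed_eq hy hb' hxy, rot_dualVec hx hy hxa ha, h2, h3, ← sq, div_self (pow_ne_zero 2 hxy)]

theorem isUnitaryFrame_frameH3 {p : V3 × V3} (hp : p ∈ geodesicsH3.carrier) {a : V3}
    (hxa : ip 1 p.1 a = 0) (ha : ip 1 a a = 1) :
    IsUnitaryFrame geodesicsH3 p (frameH3 p a) := by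
  have hx := (mem_baseSurface_one hp.1).1
  have hy := (mem_baseSurface_one hp.2.1).1
  obtain ⟨m1, m2, m3, m4⟩ := mixed_dualVec hx hy (one_add_ip_pos hp).ne' hxa ha
  have hb := ip_dualVec (x := p.1) (a := a) hy
  have hb' : ip 1 p.2 (rot 1 p.2 (dualVec p.1 p.2 a)) = 0 := ip_rot_self_left (by norm_num) _ _
  have hc : ip 1 p.1 (rot 1 p.1 a) = 0 := ip_rot_self_left (by norm_num) _ _
  refine ⟨?_, ?_, ?_, ?_⟩
  · have hl {u v : V3} (hu : ip 1 p.1 u = 0) (hv : ip 1 p.2 v = 0) :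
        (u, v) ∈ geodesicsH3.tangent p :=
      ⟨(dotProduct_eq_ip _ _).trans hu, (dotProduct_eq_ip _ _).trans hv⟩
    intro i
    fin_cases i <;> refine hl ?_ ?_ <;> simp only [hxa, hb, hb', hc, ip_neg_right, neg_zero]
  · have h0 : frameH3 p a 0 = (a, dualVec p.1 p.2 a) := rfl
    have h1 : frameH3 p a 1 = (rot 1 p.1 a, rot 1 p.2 (dualVec p.1 p.2 a)) := rfl
    have h2 : frameH3 p a 2 = (a, -dualVec p.1 p.2 a) := rfl
    have h3 : frameH3 p a 3 = (rot 1 p.1 a, -rot 1 p.2 (dualVec p.1 p.2 a)) := rfl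
    have s0 : sig 0 = 1 := rfl
    have s1 : sig 1 = 1 := rfl
    have s2 : sig 2 = -1 := rfl
    have s3 : sig 3 = -1 := rfl
    simp only [geodesicsH3]
    simp only [Fin.forall_fin_succ, IsEmpty.forall_iff, and_true, Fin.succ_zero_eq_one,
      Fin.succ_one_eq_two, Fin.isValue, Fin.reduceSucc, h0, h1, h2, h3, m1, m2, m3, m4,
      mixed_neg_right]
    norm_num +decide [s0, s1, s2, s3]
  · change (p.1 ⨯₃ a, p.2 ⨯₃ _) = (_, _)
    rw [cross_eq_rot, cross_eq_rot]
    rfl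
  · change (p.1 ⨯₃ a, p.2 ⨯₃ (-dualVec p.1 p.2 a)) = (_, _)
    rw [cross_eq_rot, cross_eq_rot, ← neg_one_smul ℝ (dualVec p.1 p.2 a), rot_smul, neg_one_smul]

end Frame

/-- The metric symmetrises `mixed`; its antisymmetrisation, together with the two area forms,
supplies all the test forms needed. -/
theorem isAntiSelfDual_H3 {p : V3 × V3} (hp : p ∈ geodesicsH3.carrier)
    {s₁ s₂ s₃ : ℝ} {σ : LinearMap.BilinForm ℝ (V3 × V3)}
    (hσ : ∀ X Y, σ X Y = s₁ * det3 p.1 X.1 Y.1 + s₂ * det3 p.2 X.2 Y.2 +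
      s₃ * (mixed p.1 p.2 X.1 Y.2 - mixed p.1 p.2 Y.1 X.2)) :
    IsAntiSelfDual geodesicsH3 p σ := by
  obtain ⟨a, ha, ha1⟩ := exists_unit_tangent (.inl rfl) (mem_baseSurface_one hp.1)
  have halt : σ.IsAlt := fun X => by
    rw [hσ, det3_self_right, det3_self_right]; ring
  refine ⟨halt, frameH3 p a, isUnitaryFrame_frameH3 hp ha ha1, ?_⟩
  rw [antiSelfDual_iff _ _ halt]
  obtain ⟨m1, m2, m3, m4⟩ := mixed_dualVec (mem_baseSurface_one hp.1).1
    (mem_baseSurface_one hp.2.1).1 (one_add_ip_pos hp).ne' ha ha1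
  have h0 : frameH3 p a 0 = (a, dualVec p.1 p.2 a) := rfl
  have h1 : frameH3 p a 1 = (rot 1 p.1 a, rot 1 p.2 (dualVec p.1 p.2 a)) := rfl
  have h2 : frameH3 p a 2 = (a, -dualVec p.1 p.2 a) := rfl
  have h3 : frameH3 p a 3 = (rot 1 p.1 a, -rot 1 p.2 (dualVec p.1 p.2 a)) := rfl
  have hs := det3_swap p.1 a (rot 1 p.1 a)
  have hs' := det3_swap p.2 (dualVec p.1 p.2 a) (rot 1 p.2 (dualVec p.1 p.2 a))
  have hn1 (x u v : V3) : det3 x (-u) v = -det3 x u v := by simp [det3_eq]; ring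
  have hn2 (x u v : V3) : det3 x u (-v) = -det3 x u v := by simp [det3_eq]; ring
  simp only [hσ, h0, h1, h2, h3, m1, m2, m3, m4, mixed_neg_right, det3_self_right, hs, hs', hn1,
    hn2]
  exact ⟨by ring, trivial, by ring⟩

theorem isBetaPlane_H3 {p : V3 × V3} (hp : p ∈ geodesicsH3.carrier)
    {L : Plane →L[ℝ] V3 × V3} (hL : IsBetaPlane geodesicsH3 p L) (X Y : Plane) :
    det3 p.1 (L X).1 (L Y).1 = 0 ∧ det3 p.2 (L X).2 (L Y).2 = 0 ∧
    mixed p.1 p.2 (L X).1 (L Y).2 = mixed p.1 p.2 (L Y).1 (L X).2 := by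
  let F := LinearMap.fst ℝ V3 V3
  let G := LinearMap.snd ℝ V3 V3
  let d₁ : LinearMap.BilinForm ℝ (V3 × V3) := (det3L p.1).compl₁₂ F F
  let d₂ : LinearMap.BilinForm ℝ (V3 × V3) := (det3L p.2).compl₁₂ G G
  let d₃ : LinearMap.BilinForm ℝ (V3 × V3) :=
    (mixedL p.1 p.2).compl₁₂ F G - (mixedL p.1 p.2).flip.compl₁₂ G F
  have h1 := hL.2 d₁ (isAntiSelfDual_H3 hp (s₁ := 1) (s₂ := 0) (s₃ := 0) fun X Y => by
    rw [one_mul, zero_mul, zero_mul, add_zero, add_zero]; rfl) X Y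
  have h2 := hL.2 d₂ (isAntiSelfDual_H3 hp (s₁ := 0) (s₂ := 1) (s₃ := 0) fun X Y => by
    rw [one_mul, zero_mul, zero_mul, add_zero, zero_add]; rfl) X Y
  have h3 := hL.2 d₃ (isAntiSelfDual_H3 hp (s₁ := 0) (s₂ := 0) (s₃ := 1) fun X Y => by
    rw [one_mul, zero_mul, zero_mul, zero_add, zero_add]; rfl) X Y
  exact ⟨h1, h2, sub_eq_zero.1 h3⟩

/-- The tangent planes of β-surfaces of `𝕃(H³)` are products of lines which are tangent to a common
circle through `p.1` and `-p.2`. -/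
theorem IsBetaPlane.exists_direction_H3 {p : V3 × V3} (hp : p ∈ geodesicsH3.carrier)
    {L : Plane →L[ℝ] V3 × V3} (hL : IsBetaPlane geodesicsH3 p L)
    (hT : ∀ X, L X ∈ tangentS2S2 p) :
    ∃ X Z, (L X).1 ≠ 0 ∧ (L Z).1 = 0 ∧ (L Z).2 ≠ 0 ∧
      ∀ X, (L X).1 ≠ 0 → ∀ Y, (∃ r : ℝ, (L Y).1 = r • (L X).1) ∧
        det3 (L X).1 (p.1 + p.2) (L Y).2 = 0 := by
  have hx := mem_baseSurface_one hp.1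
  have hy := mem_baseSurface_one hp.2.1
  have hT1 (X) : ip 1 p.1 (L X).1 = 0 := (dotProduct_eq_ip _ _).symm.trans (hT X).1
  have hT2 (X) : ip 1 p.2 (L X).2 = 0 := (dotProduct_eq_ip _ _).symm.trans (hT X).2
  let A : Plane →ₗ[ℝ] V3 := LinearMap.fst ℝ V3 V3 ∘ₗ L.toLinearMap
  let B : Plane →ₗ[ℝ] V3 := LinearMap.snd ℝ V3 V3 ∘ₗ L.toLinearMap
  have hA (X Y) (hX : A X ≠ 0) : ∃ r : ℝ, A Y = r • A X :=
    parallel_of_det3 (.inl rfl) hx (hT1 X) (hT1 Y) hX (isBetaPlane_H3 hp hL X Y).1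
  obtain ⟨X, Z, hX, hZ, hZ', h⟩ := rank_one_pair A B (μ := mixed p.1 p.2) hA
    (fun X Y hX => parallel_of_det3 (.inl rfl) hy (hT2 X) (hT2 Y) hX
      (isBetaPlane_H3 hp hL X Y).2.1)
    (fun X hA hB => hL.1 ((Prod.ext hA hB).trans (map_zero L).symm))
    (fun u => by simp [mixed, det3_eq]) (fun u v r => mixed_smul_right _ _ r u v)
    (fun X Y => (isBetaPlane_H3 hp hL X Y).2.2)
  refine ⟨X, Z, hX, hZ, hZ', fun X hX Y => ⟨hA X Y hX, ?_⟩⟩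
  have h0 : mixed p.1 p.2 (L X).1 (L Y).2 = 0 := h X Y
  have hpos := (one_add_ip_pos hp).ne'
  rw [mixed_eq hy.1 (hT2 Y) hpos] at h0
  exact (div_eq_zero_iff.1 h0).resolve_right (pow_ne_zero 2 hpos)

/-! ### β-surfaces of `𝕃(H³)` -/

/-- `lorentz` as a continuous bilinear form. -/
def lorentzL : (V3 × ℝ) →L[ℝ] (V3 × ℝ) →L[ℝ] ℝ :=
  bilinCLM (LinearMap.mk₂ ℝ lorentz
    (by intros; simp [lorentz, add_dotProduct]; ring)
    (by intros; simp [lorentz, smul_dotProduct]; ring)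
    (by intros; simp [lorentz, dotProduct_add]; ring)
    (by intros; simp [lorentz, dotProduct_smul]; ring))

theorem lorentzL_apply (P Q : V3 × ℝ) : lorentzL P Q = ip 1 P.1 Q.1 - P.2 * Q.2 := by
  rw [← dotProduct_eq_ip]; rfl

theorem tangent_H3_of_contDiffAt {g : Plane → V3 × V3} {y : Plane} (hg : ContDiffAt ℝ ∞ g y)
    (h : ∀ᶠ z in nhds y, g z ∈ geodesicsH3.carrier) (Y : Plane) :
    fderiv ℝ g y Y ∈ tangentS2S2 (g y) := by
  have hd : DifferentiableAt ℝ g y := hg.differentiableAt (by simp)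
  have e1 : fderiv ℝ (fun z => (g z).1) y Y = (fderiv ℝ g y Y).1 := by
    rw [fderiv.fst hd]; rfl
  have e2 : fderiv ℝ (fun z => (g z).2) y Y = (fderiv ℝ g y Y).2 := by
    rw [fderiv.snd hd]; rfl
  have h1 := fderiv_ip (ε := 1) hd.fst hd.fst Y
  rw [fderiv_apply_eq_zero_of_eventually_const
    (h.mono fun z hz => (mem_baseSurface_one hz.1).1), e1, ip_comm 1 _ (g y).1] at h1
  have h2 := fderiv_ip (ε := 1) hd.snd hd.snd Y
  rw [fderiv_apply_eq_zero_of_eventually_const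
    (h.mono fun z hz => (mem_baseSurface_one hz.2.1).1), e2, ip_comm 1 _ (g y).2] at h2
  exact ⟨(dotProduct_eq_ip _ _).trans (by linarith), (dotProduct_eq_ip _ _).trans (by linarith)⟩

/-- If `a ⟂ x`, then `x × (a × (x + y)) = (1 + ⟨x, y⟩) a ≠ 0`; likewise with `y` in place of `x`. -/
theorem cross_add_ne_zero {p : V3 × V3} (hp : p ∈ geodesicsH3.carrier) {a : V3} (ha0 : a ≠ 0)
    (ha : ip 1 p.1 a = 0 ∨ ip 1 p.2 a = 0) : rot 1 a (p.1 + p.2) ≠ 0 := by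
  intro h
  have hx := (mem_baseSurface_one hp.1).1
  have hy := (mem_baseSurface_one hp.2.1).1
  have hpos := one_add_ip_pos hp
  have hrot0 (x : V3) : rot 1 x 0 = 0 := by simpa using rot_smul (ε := 1) x 0 0
  have key (x : V3) (hxa : ip 1 x a = 0) (hxp : ip 1 x (p.1 + p.2) = 1 + ip 1 p.1 p.2) : False := by
    have := rot_rot_eq x a (p.1 + p.2)
    rw [h, hrot0, hxa, hxp, zero_smul, sub_zero] at this
    exact (smul_ne_zero hpos.ne' ha0) this.symm
  rcases ha with ha | ha
  · exact key p.1 ha (by rw [ip_add_right, hx])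
  · exact key p.2 ha (by rw [ip_add_right, hy, ip_comm 1 p.2, add_comm])

/-- Locally, the plane through the ideal end points `x` and `-y` containing the tangent direction
of `x` is constant. -/
theorem exists_local_conormal_H3 {g : Plane → V3 × V3} {D : Set Plane}
    (hD : IsOpen D) (hg : ContDiffOn ℝ ∞ g D) (hgM : ∀ y ∈ D, g y ∈ geodesicsH3.carrier)
    (hβ : ∀ y ∈ D, IsBetaPlane geodesicsH3 (g y) (fderiv ℝ g y)) {y₀ : Plane}
    (hy₀ : y₀ ∈ D) :
    ∃ (m : V3) (d : ℝ), m ≠ 0 ∧ ∀ᶠ y in nhds y₀, ip 1 m (g y).1 = d ∧ ip 1 m (g y).2 = -d ∧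
      ∀ Y, ip 1 m (fderiv ℝ g y Y).1 = 0 ∧ ip 1 m (fderiv ℝ g y Y).2 = 0 := by
  have h11 : (1 : ℝ) * 1 = 1 := one_mul 1
  have hgy {y} (hy : y ∈ D) : ContDiffAt ℝ ∞ g y := hg.contDiffAt (hD.mem_nhds hy)
  have hd {y} (hy : y ∈ D) : DifferentiableAt ℝ g y := (hgy hy).differentiableAt (by simp)
  have hT {y} (hy : y ∈ D) (Y) : fderiv ℝ g y Y ∈ tangentS2S2 (g y) :=
    tangent_H3_of_contDiffAt (hgy hy) (Filter.mem_of_superset (hD.mem_nhds hy) hgM) Y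
  have hT1 {y} (hy : y ∈ D) (Y) : ip 1 (g y).1 (fderiv ℝ g y Y).1 = 0 :=
    (dotProduct_eq_ip _ _).symm.trans (hT hy Y).1
  have hT2 {y} (hy : y ∈ D) (Y) : ip 1 (g y).2 (fderiv ℝ g y Y).2 = 0 :=
    (dotProduct_eq_ip _ _).symm.trans (hT hy Y).2
  have hdir {y} (hy : y ∈ D) := (hβ y hy).exists_direction_H3 (hgM y hy) (hT hy)
  obtain ⟨X, -, hX, -⟩ := hdir hy₀
  have hdX {y} (hy : y ∈ D) : DifferentiableAt ℝ (fun z => (fderiv ℝ g z X).1) y := by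
    have : DifferentiableAt ℝ (fderiv ℝ g) y :=
      ((hgy hy).fderiv_right (m := 1) (by norm_cast)).differentiableAt (by simp)
    fun_prop
  -- `μ` is normal to the plane of `ℝ³` through `x` and `-y` that contains the direction of `dx`;
  -- the second entry of `ν` below is the offset of that plane.
  set μ : Plane → V3 := fun y => rot 1 (fderiv ℝ g y X).1 ((g y).1 + (g y).2)
  have hμ {y} (hy : y ∈ D) : DifferentiableAt ℝ μ y :=
    differentiableAt_rot (hdX hy) ((hd hy).fst.add (hd hy).snd)
  set ν : Plane → V3 × ℝ := fun y => (μ y, ip 1 (μ y) (g y).1)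
  have hν {y} (hy : y ∈ D) : DifferentiableAt ℝ ν y :=
    (hμ hy).prodMk (differentiableAt_ip (hμ hy) (hd hy).fst)
  have hμ2 (y) : ip 1 (μ y) (g y).2 = -ip 1 (μ y) (g y).1 := by
    have h := ip_rot_self_right h11 (fderiv ℝ g y X).1 ((g y).1 + (g y).2)
    rw [ip_comm, ip_add_right] at h
    linarith
  set m₀ := μ y₀
  have hm₀ : m₀ ≠ 0 := cross_add_ne_zero (hgM y₀ hy₀) hX (.inl (hT1 hy₀ X))
  set ℓ : Plane → ℝ := fun y => ip 1 m₀ (μ y)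
  have hℓ {y} (hy : y ∈ D) : DifferentiableAt ℝ ℓ y :=
    differentiableAt_ip (differentiableAt_const m₀) (hμ hy)
  set n : Plane → V3 × ℝ := fun y => (ℓ y)⁻¹ • ν y
  obtain ⟨r, hr, hball⟩ := Metric.mem_nhds_iff.1 (Filter.inter_mem (hD.mem_nhds hy₀)
    (Filter.inter_mem ((hdX hy₀).continuousAt.eventually_ne hX)
      ((hℓ hy₀).continuousAt.eventually_ne (ip_one_self_pos hm₀).ne')))
  have hDy {y} (hy : y ∈ Metric.ball y₀ r) : y ∈ D := (hball hy).1
  have hXy {y} (hy : y ∈ Metric.ball y₀ r) : (fderiv ℝ g y X).1 ≠ 0 := (hball hy).2.1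
  have hℓy {y} (hy : y ∈ Metric.ball y₀ r) : ℓ y ≠ 0 := (hball hy).2.2
  have hn {y} (hy : y ∈ Metric.ball y₀ r) : DifferentiableAt ℝ n y :=
    ((hℓ (hDy hy)).inv (hℓy hy)).smul (hν (hDy hy))
  set F₁ : Plane → V3 × ℝ := fun z => ((g z).1, 1)
  set F₂ : Plane → V3 × ℝ := fun z => (-(g z).2, 1)
  have hF₁ {y} (hy : y ∈ D) : ContDiffAt ℝ ∞ F₁ y := (hgy hy).fst.prodMk contDiffAt_const
  have hF₂ {y} (hy : y ∈ D) : ContDiffAt ℝ ∞ F₂ y := (hgy hy).snd.neg.prodMk contDiffAt_const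
  have e1 {y} (hy : y ∈ D) (Y) : fderiv ℝ F₁ y Y = ((fderiv ℝ g y Y).1, 0) := by
    rw [((hd hy).hasFDerivAt.fst.prodMk (hasFDerivAt_const (1 : ℝ) y)).fderiv]; rfl
  have e2 {y} (hy : y ∈ D) (Y) : fderiv ℝ F₂ y Y = (-(fderiv ℝ g y Y).2, 0) := by
    have h : HasFDerivAt F₂ _ y :=
      (hd hy).hasFDerivAt.snd.neg.prodMk (hasFDerivAt_const (1 : ℝ) y)
    rw [h.fderiv]; rfl
  have hnx (y) : lorentzL (n y) (F₁ y) = 0 := by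
    simp only [n, map_smul, smul_apply, lorentzL_apply, ν, F₁]
    simp
  have hny (y) : lorentzL (n y) (F₂ y) = 0 := by
    simp only [n, map_smul, smul_apply, lorentzL_apply, ν, F₂, ip_neg_right, hμ2]
    simp
  have hμ1' {y} (hy : y ∈ Metric.ball y₀ r) (Y) : ip 1 (μ y) (fderiv ℝ g y Y).1 = 0 := by
    obtain ⟨-, -, -, -, -, h⟩ := hdir (hDy hy)
    obtain ⟨k, hk⟩ := (h X (hXy hy) Y).1
    rw [hk, ip_smul_right, ip_comm, ip_rot_self_left h11, mul_zero]
  have hμ2' {y} (hy : y ∈ Metric.ball y₀ r) (Y) : ip 1 (μ y) (fderiv ℝ g y Y).2 = 0 := by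
    obtain ⟨-, -, -, -, -, h⟩ := hdir (hDy hy)
    rw [ip_rot 1 h11, (h X (hXy hy) Y).2]
  have hn1 {y} (hy : y ∈ Metric.ball y₀ r) (Y) : lorentzL (n y) (fderiv ℝ F₁ y Y) = 0 := by
    rw [e1 (hDy hy)]
    simp only [n, map_smul, smul_apply, lorentzL_apply, ν, hμ1' hy]
    simp
  have hn2 {y} (hy : y ∈ Metric.ball y₀ r) (Y) : lorentzL (n y) (fderiv ℝ F₂ y Y) = 0 := by
    rw [e2 (hDy hy)]
    simp only [n, map_smul, smul_apply, lorentzL_apply, ν, ip_neg_right, hμ2' hy]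
    simp
  have hℓn {y} (hy : y ∈ Metric.ball y₀ r) : ip 1 m₀ (n y).1 = 1 := by
    simp only [n, ν, Prod.smul_fst, ip_smul_right]
    exact inv_mul_cancel₀ (hℓy hy)
  have hdn {y} (hy : y ∈ Metric.ball y₀ r) : fderiv ℝ n y = 0 := by
    have hyD := hDy hy
    have hnhds := Metric.isOpen_ball.mem_nhds hy
    obtain ⟨-, Z, -, hZ, hZ', -⟩ := hdir hyD
    have hlor {F : Plane → V3 × ℝ} (hF : DifferentiableAt ℝ F y)
        (h0 : ∀ z, lorentzL (n z) (F z) = 0) (h1 : ∀ Y, lorentzL (n y) (fderiv ℝ F y Y) = 0) (Y) :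
        lorentzL (fderiv ℝ n y Y) (F y) = 0 := by
      have h2 : HasFDerivAt (fun z => lorentzL (n z)) (lorentzL ∘L fderiv ℝ n y) y :=
        lorentzL.hasFDerivAt.comp y (hn hy).hasFDerivAt
      have h3 := congrArg (fun L => L Y) (h2.clm_apply hF.hasFDerivAt).fderiv
      simp only at h3
      rw [fderiv_apply_eq_zero_of_eventually_const (.of_forall h0)] at h3
      simpa [h1] using h3.symm
    have hx := hlor ((hF₁ hyD).differentiableAt (by simp)) hnx (hn1 hy)
    have hy' := hlor ((hF₂ hyD).differentiableAt (by simp)) hny (hn2 hy)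
    have hl (Y) : ip 1 m₀ (fderiv ℝ n y Y).1 = 0 := by
      have h1 := fderiv_ip (ε := 1) (differentiableAt_const m₀) (hn hy).fst Y
      rw [fderiv_apply_eq_zero_of_eventually_const
        (Filter.mem_of_superset hnhds fun z hz => hℓn hz), fderiv.fst (hn hy)] at h1
      simpa [ip_zero_left] using h1.symm
    -- Orthogonality of `dn` to `F₁` and `F₂` makes its spatial part orthogonal to `x + y`. If also
    -- orthogonal to `b`, it is a multiple of `b × (x + y)`, as is `μ`, and the normalisation by
    -- `m₀` makes it zero. The last entry then vanishes too.
    have key (Y) {b : V3} (hb : rot 1 b ((g y).1 + (g y).2) ≠ 0) (hμb : ip 1 (μ y) b = 0)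
        (h : ip 1 (fderiv ℝ n y Y).1 b = 0) : fderiv ℝ n y Y = 0 := by
      have h1 := hx Y
      have h2 := hy' Y
      simp only [lorentzL_apply, F₁, F₂, ip_neg_right, mul_one] at h1 h2
      obtain ⟨k, hk⟩ := eq_smul_cross hb h (by rw [ip_add_right]; linarith)
      obtain ⟨l, hl'⟩ := eq_smul_cross hb hμb (by rw [ip_add_right, hμ2]; ring)
      have h3 : ip 1 m₀ (rot 1 b ((g y).1 + (g y).2)) ≠ 0 := by
        intro h3
        apply hℓy hy
        change ip 1 m₀ (μ y) = 0
        rw [hl', ip_smul_right, h3, mul_zero]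
      have h4 := hl Y
      rw [hk, ip_smul_right] at h4
      have h5 : (fderiv ℝ n y Y).1 = 0 := by
        rw [hk, (mul_eq_zero.1 h4).resolve_right h3, zero_smul]
      refine Prod.ext h5 ?_
      rw [h5, ip_zero_left] at h1
      simpa using h1
    refine fderiv_conormal_eq_zero lorentzL (F₁ := F₁) (F₂ := F₂)
      (X := X) (Z := Z) (hn hy) (hF₁ hyD) (hF₂ hyD)
      (Filter.mem_of_superset hnhds fun z hz => hn1 hz)
      (Filter.mem_of_superset hnhds fun z hz => hn2 hz) ?_ ?_ ?_
    · rw [e1 hyD, hZ]; rfl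
    · intro Y h
      rw [e1 hyD, lorentzL_apply] at h
      exact key Y (cross_add_ne_zero (hgM y hyD) (hXy hy) (.inl (hT1 hyD X))) (hμ1' hy X)
        (by simpa using h)
    · intro Y h
      rw [e2 hyD, lorentzL_apply] at h
      exact key Y (cross_add_ne_zero (hgM y hyD) hZ' (.inr (hT2 hyD Z))) (hμ2' hy Z)
        (by simpa [ip_neg_right] using h)
  have hcn {y} (hy : y ∈ Metric.ball y₀ r) : n y = n y₀ :=
    Metric.isOpen_ball.is_const_of_fderiv_eq_zero (convex_ball y₀ r).isPreconnected
      (fun z hz => (hn hz).differentiableWithinAt) (fun z hz => hdn hz) hy (Metric.mem_ball_self hr)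
  refine ⟨(n y₀).1, (n y₀).2, ?_,
    Filter.mem_of_superset (Metric.ball_mem_nhds y₀ hr) fun y hy => ?_⟩
  · intro h
    have := hℓn (Metric.mem_ball_self hr)
    simp [h, ip_zero_right] at this
  · have h1 := hnx y
    have h2 := hny y
    simp only [lorentzL_apply, F₁, F₂, ip_neg_right, mul_one] at h1 h2
    rw [hcn hy] at h1 h2
    refine ⟨by linarith, by linarith, fun Y => ?_⟩
    have h3 := hn1 hy Y
    have h4 := hn2 hy Y
    rw [e1 (hDy hy), lorentzL_apply, hcn hy] at h3
    rw [e2 (hDy hy), lorentzL_apply, hcn hy] at h4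
    simp only [ip_neg_right, mul_zero, sub_zero, neg_eq_zero] at h3 h4
    exact ⟨h3, h4⟩

/-! ### Circles and totally geodesic planes -/

/-- The circle cut out of `S²` by the plane `m ⬝ᵥ x = d`. -/
def circleOf (m : V3) (d : ℝ) : Set V3 := {x | x ∈ sphere2 ∧ m ⬝ᵥ x = d}

theorem circleOf_smul {m : V3} {d t : ℝ} (ht : t ≠ 0) :
    circleOf (t • m) (t * d) = circleOf m d := by
  ext x
  simp only [circleOf, mem_ofPred_eq, smul_dotProduct, smul_eq_mul, mul_right_inj' ht]

/-- Here `|m - d x|² = |m|² - d²`. Equality `m = d x` would give `d (1 + ⟨x, y⟩) = 0`, hence `m =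
0`. -/
theorem sq_lt_of_mem {m : V3} {d : ℝ} (hm : m ≠ 0) {p : V3 × V3} (hp : p ∈ geodesicsH3.carrier)
    (h1 : ip 1 m p.1 = d) (h2 : ip 1 m p.2 = -d) : d ^ 2 < ip 1 m m := by
  have hx := (mem_baseSurface_one hp.1).1
  have hne : m - d • p.1 ≠ 0 := by
    intro h
    have hm' := sub_eq_zero.1 h
    rw [hm', ip_smul_left] at h2
    have hd : d * (1 + ip 1 p.1 p.2) = 0 := by linarith
    have hd0 := (mul_eq_zero.1 hd).resolve_right (one_add_ip_pos hp).ne'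
    rw [hd0, zero_smul] at hm'
    exact hm hm'
  have := ip_one_self_pos hne
  simp only [ip_sub_left, ip_sub_right, ip_smul_left, ip_smul_right, hx, ip_comm 1 p.1 m, h1]
    at this
  linarith

/-- Near `x`, the circle has the coordinate `⟨·, a⟩`, where `a` is a tangent vector at `x`. -/
theorem exists_nhds_circle_inj {m x a : V3} {d : ℝ} (hx : x ∈ circleOf m d) (ha0 : a ≠ 0)
    (hxa : ip 1 x a = 0) (hma : ip 1 m a = 0) (hd : d ^ 2 < ip 1 m m) :
    ∃ O ∈ nhds x, ∀ y ∈ circleOf m d ∩ O, ∀ z ∈ circleOf m d ∩ O, ip 1 a y = ip 1 a z → y = z := by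
  have h11 : (1 : ℝ) * 1 = 1 := one_mul 1
  have hip {y} (hy : y ∈ circleOf m d) : ip 1 y y = 1 ∧ ip 1 m y = d :=
    ⟨(mem_baseSurface_one hy.1).1, (dotProduct_eq_ip _ _).symm.trans hy.2⟩
  obtain ⟨hxx, hmx⟩ := hip hx
  set w := rot 1 m a
  have hxm : rot 1 x m ≠ 0 := by
    intro h
    have h1 := rot_rot_eq x x m
    have h2 : rot 1 x (0 : V3) = 0 := by simpa using rot_smul (ε := 1) x 0 0
    rw [h, h2, hxx, one_smul, ip_comm, hmx] at h1
    rw [← sub_eq_zero.1 h1.symm, ip_smul_left, ip_smul_right, hxx] at hd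
    linarith
  -- The tangent vector `a` is a multiple of `x × m`, so `m`, `a`, `x` are independent. Two points
  -- of the circle with equal coordinate then differ by a multiple of `w`, which the half-space
  -- around `x` rules out.
  have hwx : ip 1 w x ≠ 0 := by
    obtain ⟨k, hk⟩ := eq_smul_cross hxm ((ip_comm _ _ _).trans hxa) ((ip_comm _ _ _).trans hma)
    have hk0 : k ≠ 0 := by rintro rfl; exact ha0 (by rw [hk, zero_smul])
    have h1 : ip 1 w x = ip 1 (rot 1 x m) a := by
      rw [ip_rot 1 h11, ip_rot 1 h11]; simp only [det3_eq]; ring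
    rw [h1, hk, ip_smul_right]
    exact mul_ne_zero hk0 (ip_one_self_pos hxm).ne'
  have hw : w ≠ 0 := fun h => hwx (by rw [h, ip_zero_left])
  refine ⟨{y | 0 < ip 1 w y * ip 1 w x}, IsOpen.mem_nhds ?_ ?_, ?_⟩
  · refine isOpen_lt continuous_const ?_
    simp only [ip]
    fun_prop
  · exact mul_self_pos.2 hwx
  · rintro y ⟨hy, hyO⟩ z ⟨hz, hzO⟩ hyz
    obtain ⟨hyy, hmy⟩ := hip hy
    obtain ⟨hzz, hmz⟩ := hip hz
    obtain ⟨k, hk⟩ := eq_smul_cross (u := y - z) hw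
      (by rw [ip_comm, ip_sub_right, hmy, hmz, sub_self])
      (by rw [ip_comm, ip_sub_right, hyz, sub_self])
    have h1 : ip 1 (y - z) (y + z) = 0 := by
      rw [ip_sub_left, ip_add_right, ip_add_right, hyy, hzz, ip_comm 1 z y]; ring
    rw [hk, ip_smul_left, ip_add_right] at h1
    have hk0 : k = 0 := by
      refine (mul_eq_zero.1 h1).resolve_right fun h2 => ?_
      have h3 : (ip 1 w y + ip 1 w z) * ip 1 w x = 0 := by rw [h2, zero_mul]
      have hyO : 0 < ip 1 w y * ip 1 w x := hyO
      have hzO : 0 < ip 1 w z * ip 1 w x := hzO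
      linarith
    rw [hk0, zero_smul] at hk
    exact sub_eq_zero.1 hk

/-- The oriented geodesics of the totally geodesic plane with unit normal `(m, d)` are those whose
ideal end points lie on the circle `m ⬝ᵥ x = d`. -/
theorem torus_eq_geodesicsH2 (m : V3) (d : ℝ) :
    (circleOf m d ×ˢ circleOf (-m) d) ∩ geodesicsH3.carrier = geodesicsH2 (m, d) := by
  ext p
  have hlor (s t : ℝ) : lorentz (m, d) (s • ((p.1, 1) : V3 × ℝ) + t • ((-p.2, 1) : V3 × ℝ)) =
      s * (m ⬝ᵥ p.1 - d) + t * (-m ⬝ᵥ p.2 - d) := by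
    simp [lorentz, dotProduct_add, dotProduct_smul]; ring
  constructor
  · rintro ⟨⟨h1, h2⟩, hp⟩
    refine ⟨hp, ?_⟩
    rintro P ⟨hP, s, t, rfl⟩
    refine ⟨hP, ?_⟩
    rw [hlor, h1.2, h2.2]; ring
  · rintro ⟨hp, hsub⟩
    have hpos := one_add_ip_pos hp
    have hx := (mem_baseSurface_one hp.1).1
    have hy := (mem_baseSurface_one hp.2.1).1
    -- The combination `s (x, 1) + t (-y, 1)` has Lorentz square `-2 s t (1 + ⟨x, y⟩)`, so the
    -- geodesic consists of those with `s t = κ` and `s, t > 0`.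
    set κ := (2 * (1 + ip 1 p.1 p.2))⁻¹
    have hκ : 0 < κ := by positivity
    have hκ1 : κ * (1 + ip 1 p.1 p.2) = 1 / 2 := by simp only [κ]; field_simp
    have key (s t : ℝ) (hs : 0 < s) (ht : 0 < t) (hst : s * t = κ) :
        s * (m ⬝ᵥ p.1 - d) + t * (-m ⬝ᵥ p.2 - d) = 0 := by
      rw [← hlor]
      refine (hsub ⟨⟨?_, ?_⟩, s, t, rfl⟩).2
      · simp only [lorentz, dotProduct_eq_ip, Prod.fst_add, Prod.smul_fst, Prod.snd_add,
          Prod.smul_snd, ip_add_left, ip_add_right, ip_smul_left, ip_smul_right, ip_neg_left,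
          ip_neg_right, hx, hy, ip_comm 1 p.2 p.1, smul_eq_mul]
        rw [← hst] at hκ1
        linear_combination -2 * hκ1
      · simp; positivity
    -- Two distinct points of the geodesic give two independent linear equations for the end point
    -- conditions.
    have k1 := key 1 κ one_pos hκ (one_mul κ)
    have k2 := key 2 (κ / 2) two_pos (by positivity) (by ring)
    have hA : m ⬝ᵥ p.1 = d := by linarith
    have hB : -m ⬝ᵥ p.2 = d := by
      have : κ * (-m ⬝ᵥ p.2 - d) = 0 := by linarith
      linarith [(mul_eq_zero.1 this).resolve_left hκ.ne']
    exact ⟨⟨⟨hp.1, hA⟩, hp.2.1, hB⟩, hp⟩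

theorem isIsometry_id {W : Type*} [NormedAddCommGroup W] [NormedSpace ℝ W] (M : NeutralData W) :
    IsIsometry M id := by
  refine ⟨bijOn_id _, ⟨univ, isOpen_univ, subset_univ _, contDiffOn_id⟩,
    ⟨id, fun _ _ => rfl, univ, isOpen_univ, subset_univ _, contDiffOn_id⟩, ?_⟩
  intro p _ X _ Y _
  simp

/-! ### The global statement for `𝕃(H³)` -/

section GlobalH3

variable {S : Type*} [TopologicalSpace S] [ChartedSpace (EuclideanSpace ℝ (Fin 2)) S]
  [IsManifold (𝓡 2) ∞ S] [ConnectedSpace S]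

/-- As for `TN`, the conormal `(m, d)` is unique up to scale and the torus is insensitive to scale.
Each circle is coordinatised near the point by the pairing with its own tangent direction. -/
theorem betaSurface_H3 {f : S → V3 × V3} (hf : IsBetaSurface geodesicsH3 f) :
    ∃ (m : V3) (d : ℝ), d ^ 2 < m ⬝ᵥ m ∧
      IsPieceOf (range f) (circleOf m d ×ˢ circleOf (-m) d) := by
  have hT (p) (X : TangentSpace (𝓡 2) p) :
      mfderiv (𝓡 2) 𝓘(ℝ, V3 × V3) f p X ∈ tangentS2S2 (f p) := by
    refine (eventually_of_chart (Q := fun w ξ => ξ ∈ tangentS2S2 w) hf.2.1 p ?_).self_of_nhds X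
    filter_upwards [extChartAt_target_mem_nhds (I := 𝓡 2) p] with y hy
    exact tangent_H3_of_contDiffAt ((contDiffOn_comp_chart_symm hf.2.1 p).contDiffAt
      ((isOpen_extChartAt_target p).mem_nhds hy)) (.of_forall fun z => hf.1 _)
  have hT1 (p) (X : TangentSpace (𝓡 2) p) :
      ip 1 (f p).1 (mfderiv (𝓡 2) 𝓘(ℝ, V3 × V3) f p X).1 = 0 :=
    (dotProduct_eq_ip _ _).symm.trans (hT p X).1
  have hT2 (p) (X : TangentSpace (𝓡 2) p) :
      ip 1 (f p).2 (mfderiv (𝓡 2) 𝓘(ℝ, V3 × V3) f p X).2 = 0 :=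
    (dotProduct_eq_ip _ _).symm.trans (hT p X).2
  have hβ (p) : IsBetaPlane geodesicsH3 (f p) (mfderiv (𝓡 2) 𝓘(ℝ, V3 × V3) f p) :=
    ⟨hf.2.2.1 p, hf.2.2.2 p⟩
  have hdir (p) := (hβ p).exists_direction_H3 (hf.1 p) (hT p)
  let R (p : S) (a : V3 × ℝ) : Prop := a.1 ≠ 0 ∧ ip 1 a.1 (f p).1 = a.2 ∧
    ip 1 a.1 (f p).2 = -a.2 ∧ ∀ X : TangentSpace (𝓡 2) p,
      ip 1 a.1 (mfderiv (𝓡 2) 𝓘(ℝ, V3 × V3) f p X).1 = 0 ∧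
      ip 1 a.1 (mfderiv (𝓡 2) 𝓘(ℝ, V3 × V3) f p X).2 = 0
  obtain ⟨⟨m, d⟩, ⟨p₀, hp₀⟩, hall⟩ := exists_global_parameter (R := R)
    (B := fun a => circleOf a.1 a.2 ×ˢ circleOf (-a.1) a.2) (fun p a b hRa hRb => by
      obtain ⟨X, -, hX, -⟩ := hdir p
      have hne := cross_add_ne_zero (hf.1 p) hX (.inl (hT1 p X))
      obtain ⟨k, hk⟩ := eq_smul_cross hne (hRa.2.2.2 X).1
        (by rw [ip_add_right, hRa.2.1, hRa.2.2.1, add_neg_cancel])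
      obtain ⟨l, hl⟩ := eq_smul_cross hne (hRb.2.2.2 X).1
        (by rw [ip_add_right, hRb.2.1, hRb.2.2.1, add_neg_cancel])
      have hk0 : k ≠ 0 := by rintro rfl; exact hRa.1 (by rw [hk, zero_smul])
      have hl0 : l ≠ 0 := by rintro rfl; exact hRb.1 (by rw [hl, zero_smul])
      simp only [← hRa.2.1, ← hRb.2.1]
      rw [hk, hl, ip_smul_left, ip_smul_left, ← smul_neg, ← smul_neg, circleOf_smul hk0,
        circleOf_smul hk0, circleOf_smul hl0, circleOf_smul hl0]) (fun p => by
      obtain ⟨m, d, hm, hev⟩ := exists_local_conormal_H3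
        (isOpen_extChartAt_target (I := 𝓡 2) p) (contDiffOn_comp_chart_symm hf.2.1 p)
        (fun y _ => hf.1 _) (fun y hy => hf.isBetaPlane_chart p hy)
        (mem_extChartAt_target (I := 𝓡 2) p)
      refine ⟨(m, d), ?_⟩
      have := eventually_of_chart (Q := fun w ξ => ip 1 m w.1 = d ∧ ip 1 m w.2 = -d ∧
        ip 1 m ξ.1 = 0 ∧ ip 1 m ξ.2 = 0) hf.2.1 p
        (hev.mono fun y hy X => ⟨hy.1, hy.2.1, hy.2.2 X⟩)
      filter_upwards [this] with q hq
      exact ⟨hm, (hq 0).1, (hq 0).2.1, fun X => (hq X).2.2⟩)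
  have hRB {p : S} {b : V3 × ℝ} (hb : R p b) :
      (f p).1 ∈ circleOf b.1 b.2 ∧ (f p).2 ∈ circleOf (-b.1) b.2 :=
    ⟨⟨(hf.1 p).1, (dotProduct_eq_ip _ _).trans hb.2.1⟩, (hf.1 p).2.1, by
      rw [dotProduct_eq_ip, ip_neg_left, hb.2.2.1, neg_neg]⟩
  refine ⟨m, d, ?_, isPieceOf_range hf.2.1 (fun p => ?_) fun p => ?_⟩
  · rw [dotProduct_eq_ip]
    exact sq_lt_of_mem hp₀.1 (hf.1 p₀) hp₀.2.1 hp₀.2.2.1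
  · obtain ⟨b, hb, hbB⟩ := hall p
    exact hbB ▸ hRB hb
  obtain ⟨X, Z, hX, hZ, hZ', hXY⟩ := hdir p
  obtain ⟨b, hb, hbB⟩ := hall p
  have hd := sq_lt_of_mem hb.1 (hf.1 p) hb.2.1 hb.2.2.1
  set u := (mfderiv (𝓡 2) 𝓘(ℝ, V3 × V3) f p X).1
  set v := (mfderiv (𝓡 2) 𝓘(ℝ, V3 × V3) f p Z).2
  obtain ⟨O₁, hO₁, hinj₁⟩ := exists_nhds_circle_inj (hRB hb).1 hX (hT1 p X) (hb.2.2.2 X).1 hd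
  obtain ⟨O₂, hO₂, hinj₂⟩ := exists_nhds_circle_inj (hRB hb).2 hZ' (hT2 p Z)
    ((ip_neg_left 1 _ _).trans (neg_eq_zero.2 (hb.2.2.2 Z).2))
    (by rwa [ip_neg_left, ip_neg_right, neg_neg])
  refine ⟨((ipL 1 u).comp (ContinuousLinearMap.fst ℝ V3 V3)).prod
    ((ipL 1 v).comp (ContinuousLinearMap.snd ℝ V3 V3)),
    ⟨O₁ ×ˢ O₂, prod_mem_nhds hO₁ hO₂, ?_⟩, ?_⟩
  · rw [← hbB]
    rintro q ⟨hq, hq'⟩ q' ⟨hr, hr'⟩ hqq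
    obtain ⟨e1, e2⟩ := Prod.mk.inj hqq
    exact Prod.ext (hinj₁ _ ⟨hq.1, hq'.1⟩ _ ⟨hr.1, hr'.1⟩ e1)
      (hinj₂ _ ⟨hq.2, hq'.2⟩ _ ⟨hr.2, hr'.2⟩ e2)
  · intro Y hY
    obtain ⟨e1, e2⟩ := Prod.mk.inj hY
    have e1 : ip 1 u (mfderiv (𝓡 2) 𝓘(ℝ, V3 × V3) f p Y).1 = 0 := e1
    have e2 : ip 1 v (mfderiv (𝓡 2) 𝓘(ℝ, V3 × V3) f p Y).2 = 0 := e2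
    have key {a b : V3} (ha : a ≠ 0) (h1 : ∃ r : ℝ, b = r • a) (h2 : ip 1 a b = 0) : b = 0 := by
      obtain ⟨r, hr⟩ := h1
      rw [hr, ip_smul_right] at h2
      rw [hr, (mul_eq_zero.1 h2).resolve_right (ip_one_self_pos ha).ne', zero_smul]
    have z1 := key hX (hXY X hX Y).1 e1
    have z2 := key hZ' (parallel_of_det3 (.inl rfl) (mem_baseSurface_one (hf.1 p).2.1)
      (hT2 p Z) (hT2 p Y) hZ' (isBetaPlane_H3 (hf.1 p) (hβ p) Z Y).2.1) e2
    exact hf.2.2.1 p ((Prod.ext z1 z2).trans (map_zero (mfderiv (𝓡 2) 𝓘(ℝ, V3 × V3) f p)).symm)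

end GlobalH3

end BetaSurf

end

theorem mainTheorem1 {S : Type*} [TopologicalSpace S]
    [ChartedSpace (EuclideanSpace ℝ (Fin 2)) S] [IsManifold (𝓡 2) ∞ S] [ConnectedSpace S]
    (f : S → BetaSurf.V3 × BetaSurf.V3) :
    (BetaSurf.IsBetaSurface (BetaSurf.tangentBundleData 1) f →
      ∃ c B, BetaSurf.HasConstGeodesicCurvature 1 c ∧ BetaSurf.IsAffineTangentBundle 1 c B ∧
        BetaSurf.IsPieceOf (range f) B) ∧
    (BetaSurf.IsBetaSurface (BetaSurf.tangentBundleData (-1)) f →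
      ∃ c B, BetaSurf.HasConstGeodesicCurvature (-1) c ∧
        BetaSurf.IsAffineTangentBundle (-1) c B ∧ BetaSurf.IsPieceOf (range f) B) ∧
    (BetaSurf.IsBetaSurface BetaSurf.geodesicsH3 f →
      ∃ K₁ K₂ : Set BetaSurf.V3, BetaSurf.IsCircle K₁ ∧ BetaSurf.IsCircle K₂ ∧
        BetaSurf.IsPieceOf (range f) (K₁ ×ˢ K₂) ∧
        ∃ Φ, BetaSurf.IsIsometry BetaSurf.geodesicsH3 Φ ∧
          ((∃ n : BetaSurf.V3 × ℝ, 0 < BetaSurf.lorentz n n ∧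
              Φ '' ((K₁ ×ˢ K₂) ∩ BetaSurf.geodesicsH3.carrier) = BetaSurf.geodesicsH2 n) ∨
            ∃ C : Set BetaSurf.V3, BetaSurf.IsCircle C ∧ BetaSurf.northPole ∈ C ∧
              Φ '' ((K₁ ×ˢ K₂) ∩ BetaSurf.geodesicsH3.carrier) =
                (C ×ˢ (BetaSurf.reflectHor '' C)) ∩ BetaSurf.geodesicsH3.carrier)) := by
  refine ⟨BetaSurf.betaSurface_TN (.inl rfl), BetaSurf.betaSurface_TN (.inr rfl), fun hf => ?_⟩
  obtain ⟨m, d, hmd, hpiece⟩ := BetaSurf.betaSurface_H3 hf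
  -- The first alternative always holds, with the identity as isometry: `(m, d)` is space-like
  -- because `d² < |m|²`.
  refine ⟨_, _, ⟨m, d, hmd, rfl⟩, ⟨-m, d, by simpa using hmd, rfl⟩, hpiece, id,
    BetaSurf.isIsometry_id _, .inl ⟨(m, d), ?_, ?_⟩⟩
  · rw [BetaSurf.lorentz]
    linarith [sq d]
  · rw [image_id]
    exact BetaSurf.torus_eq_geodesicsH2 m d
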